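/- **Setting.** A matching market consists of a finite set $I$ of buyers, a finite set $J$ of items and, for every buyer $i$, a preference-set $S_i\subseteq J$, a valuation $v_i>0$ and a budget $b_i\ge 0$. An outcome $(\mathbf X,\mathbf p)$ gives every buyer $i$ a bundle $X_i\subseteq J$ and a payment $p_i$; its revenue is $\sum_i p_i$. The utility of buyer $i$ for a bundle $X$ at payment $q$ is $u_i(X,q)=v_i|X\cap S_i|-q$ if $q\le b_i$, and $-\infty$ if $q>b_i$. An outcome is feasible if all $p_i\ge 0$, the bundles are pairwise disjoint, and $u_i(X_i,p_i)\ge 0$ for all $i$. It is pairwise (bundle-price) envy-free if $u_i(X_i,p_i)\ge u_i(X_k,p_k)$ for all $i,k$. Let $\mathcal R^{\mathrm{OPT}}$ be the supremum of the revenues of feasible pairwise envy-free outcomes. **Notation.** Let $J'$ be the current set of unsold items and $\beta_i$ the current budgets. The demand is $D_i(p)=\min\{\lfloor \beta_i/p\rfloor,|S_i|\}$ if $p\le v_i$ (with $D_i(0)=|S_i|$), and $D_i(p)=0$ if $p>v_i$. Put $A^p=\{i: v_i>p,\ D_i(p)>0\}$, $Q^p=\{i: v_i=p,\ D_i(p)>0\}$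 and $I^p=A^p\cup Q^p$. Let $G^p$ and $\bar G^p$ be the bipartite graphs between $I^p$, respectively $A^p$, and $J'$, with edges $(i,j)$ for $j\in S_i$. A matching is a set of edges with at most $D_i(p)$ edges at every buyer $i$ and at most one edge at every item; $\mathcal M(\cdot)$ denotes a maximum matching. An augmenting path for a matching $M$ is a path $y_1,z_1,\dots,y_h,z_h$ in the graph, with buyers $y_k$ and items $z_k$, such that $(y_k,z_k)\notin M$ for all $k\le h$ and $(y_{k+1},z_k)\in M$ for all $k<h$. For a set $W$ of items, $N(W)$ is the set of buyers from which an augmenting path leads to an item of $W$. A price $p$ is critical if $|\mathcal M(G^p)|>|\mathcal M(G^{p+\delta})|$ for all sufficiently small $\delta>0$. **Algorithm 1** (with a parameter $\varepsilon>0$). Start with $p=0$, $J'=J$, $\beta_i=b_i$, $X_i=\emptyset$, $p_i=0$. While $|\mathcal M(G^p)|\neq 0$, increase $p$ (possibly by $0$) to the first critical price, and then do the following. * *If $|\mathcal M(G^p)|>|\mathcal M(\bar G^p)|$:* choose a maximum matching $M_0$ of $\bar G^p$ with the minimum number of items of $\bigcup_{i\in Q^p}S_i$ matched. Let $\bar J\subseteq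 J'$ be the set of items not matched in $M_0$. Sell, at price $p$ per item, the edges of $M_0$ at buyers in $N(\bar J)$, together with an assignment of items of $\bar J$ to buyers $i\in Q^p$ that interest them, with at most $D_i(p)$ items for every such buyer $i$ and with as many items of $\bar J$ as possible assigned. * *Otherwise:* choose a maximum matching $M_0$ of $G^{p+\varepsilon}$. Let $\bar J\subseteq J'$ be the set of items not matched in $M_0$. Sell, at price $p+\varepsilon$ per item, the edges of $M_0$ at buyers in $N(\bar J)$. Then remove from $J'$ the items of $\bar J$ and all items that no buyer demands any more, i.e. that lie in no $S_i$ with $i\in I^{p+\varepsilon}$ (for the updated budgets). Selling an edge $(i,j)$ at price $q$ removes $j$ from $J'$, adds $j$ to $X_i$, adds $q$ to $p_i$ and subtracts $q$ from $\beta_i$. **Theorem.** Suppose that $b_i\ge v_i$ for all buyers $i$. Then for all sufficiently small $\varepsilon>0$ (depending on the market) Algorithm 1 terminates, and however its matchings are chosen, the outcome $(\mathbf X,\mathbf p)$ that it returns satisfies $$\sum_{i\in I}p_i\ \ge\ \tfrac14\,\mathcal R^{\mathrm{OPT}}.$$ -/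

import Mathlib

open Filter Topology

noncomputable section MatchingMarkets

open scoped Classical

/-- An instance of a matching market: buyer `i` values every item of her preference-set `S i` at
`v i > 0`, every other item at `0`, and has the budget `b i ≥ 0`. -/
structure Market (I J : Type*) where
  S : I → Finset J
  v : I → ℝ
  b : I → ℝ
  v_pos : ∀ i, 0 < v i
  b_nonneg : ∀ i, 0 ≤ b i

/-- An allocation vector together with a payment vector. -/
structure Outcome (I J : Type*) where
  X : I → Finset J
  pay : I → ℝ

/-- The revenue of an outcome is the sum of all payments. -/
def Outcome.revenue {I J : Type*} [Fintype I] (o : Outcome I J) : ℝ := ∑ i, o.pay i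

/-- The data that the ascending price auction keeps: the current price, the items that are still on
sale, the remaining budgets, and the bundles and payments so far. -/
structure AuctionState (I J : Type*) where
  price : ℝ
  unsold : Finset J
  budget : I → ℝ
  outcome : Outcome I J

namespace Market

variable {I J : Type*} (A : Market I J)

/-! ### Utilities and envy-free outcomes -/

/-- The utility of buyer `i` for the bundle `X` at payment `p`; it is `-∞` above her budget. -/
def utility (i : I) (X : Finset J) (p : ℝ) : EReal :=
  if p ≤ A.b i then ((A.v i * ((X ∩ A.S i).card : ℝ) - p : ℝ) : EReal) else ⊥

/-- Feasible outcomes: nonnegative payments, every item goes to at most one buyer (supply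
constraint), and no buyer has a negative utility (individual rationality). -/
structure IsFeasible (o : Outcome I J) : Prop where
  pay_nonneg : ∀ i, 0 ≤ o.pay i
  supply : ∀ i i', i ≠ i' → Disjoint (o.X i) (o.X i')
  rational : ∀ i, 0 ≤ A.utility i (o.X i) (o.pay i)

/-- Pairwise (bundle-price) envy-freeness: no buyer prefers the bundle-payment pair of another. -/
def IsPairwiseEnvyFree (o : Outcome I J) : Prop :=
  ∀ i k, A.utility i (o.X k) (o.pay k) ≤ A.utility i (o.X i) (o.pay i)

/-- The revenues of all feasible pairwise envy-free outcomes. -/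
def envyFreeRevenues [Fintype I] : Set ℝ :=
  {r | ∃ o : Outcome I J, A.IsFeasible o ∧ A.IsPairwiseEnvyFree o ∧ o.revenue = r}

/-- The optimal bundle-price envy-free revenue. The set is nonempty and bounded above, see
`envyFreeRevenues_nonempty` and `envyFreeRevenues_bddAbove`. -/
def optRevenue [Fintype I] : ℝ := sSup A.envyFreeRevenues

theorem envyFreeRevenues_nonempty [Fintype I] : A.envyFreeRevenues.Nonempty := by
  refine ⟨0, ⟨fun _ => ∅, fun _ => 0⟩, ⟨fun _ => le_rfl, ?_, ?_⟩, ?_, ?_⟩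
  · intro i i' _
    simp
  · intro i
    simp [utility, A.b_nonneg i]
  · intro i k
    exact le_rfl
  · simp [Outcome.revenue]

theorem envyFreeRevenues_bddAbove [Fintype I] : BddAbove A.envyFreeRevenues := by
  refine ⟨∑ i, A.b i, ?_⟩
  rintro r ⟨o, ho, _, rfl⟩
  refine Finset.sum_le_sum fun i _ => ?_
  by_contra hlt
  have h := ho.rational i
  simp [utility, hlt] at h

/-! ### Demands, preference-graphs and matchings

Budgets decrease during the auction, so the current budgets `β` are an argument. -/

/-- The demand `D_i(p) = min {⌊β_i / p⌋, |S_i|}` for `p ≤ v_i`, and `0` for `p > v_i`. At `p = 0` the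
quotient is infinite, so that the minimum is `|S_i|`. -/
def demand (β : I → ℝ) (p : ℝ) (i : I) : ℕ :=
  if p ≤ A.v i then
    if p = 0 then (A.S i).card else min ⌊β i / p⌋₊ (A.S i).card
  else 0

/-- The buyers with positive demand whose valuation exceeds `p`: the set `A^p`. -/
def buyersAbove (β : I → ℝ) (p : ℝ) : Set I := {i | p < A.v i ∧ 0 < A.demand β p i}

/-- The buyers with positive demand whose valuation equals `p`: the set `Q^p`. -/
def buyersAt (β : I → ℝ) (p : ℝ) : Set I := {i | A.v i = p ∧ 0 < A.demand β p i}

/-- `I^p = A^p ∪ Q^p`. -/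
def buyers (β : I → ℝ) (p : ℝ) : Set I := A.buyersAbove β p ∪ A.buyersAt β p

/-- `M` is a `B`-matching at price `p` of the preference-graph on the buyers `B` and the items `U`:
a set of edges `(i, j)` with `j ∈ S_i` in which every buyer `i` has at most `D_i(p)` items and every
item has at most one buyer. -/
structure IsMatching (β : I → ℝ) (p : ℝ) (B : Set I) (U : Finset J) (M : Finset (I × J)) :
    Prop where
  edge : ∀ e ∈ M, e.1 ∈ B ∧ e.2 ∈ U ∧ e.2 ∈ A.S e.1
  demand_le : ∀ i, (M.filter fun e => e.1 = i).card ≤ A.demand β p i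
  supply_le : ∀ j, (M.filter fun e => e.2 = j).card ≤ 1

/-- `M` is a `B`-matching with the maximum number of edges. -/
def IsMaxMatching (β : I → ℝ) (p : ℝ) (B : Set I) (U : Finset J) (M : Finset (I × J)) : Prop :=
  A.IsMatching β p B U M ∧ ∀ M', A.IsMatching β p B U M' → M'.card ≤ M.card

/-- The number of edges of a maximum `B`-matching. -/
def matchNum [Fintype I] [Fintype J] (β : I → ℝ) (p : ℝ) (B : Set I) (U : Finset J) : ℕ :=
  ((Finset.univ : Finset (Finset (I × J))).filter fun M => A.IsMatching β p B U M).sup Finset.card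

/-- `AugPath B U M i j`: an augmenting path `i = y₁, z₁, …, y_h, z_h = j` leads from the buyer `i` to
the item `j`; here `y_k ∈ B`, `z_k ∈ U ∩ S_{y_k}`, `(y_k, z_k) ∉ M` and `(y_{k+1}, z_k) ∈ M`. (Requiring
the vertices to be distinct would not change which pairs are connected.) -/
inductive AugPath (B : Set I) (U : Finset J) (M : Finset (I × J)) : I → J → Prop
  | last {i : I} {j : J} : i ∈ B → j ∈ U → j ∈ A.S i → (i, j) ∉ M → AugPath B U M i j
  | cons {i i' : I} {z j : J} : i ∈ B → z ∈ U → z ∈ A.S i → (i, z) ∉ M → (i', z) ∈ M →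
      AugPath B U M i' j → AugPath B U M i j

/-- The items of `U` that are not matched in `M`. -/
def unmatched (U : Finset J) (M : Finset (I × J)) : Finset J := U \ M.image Prod.snd

/-- `N(W)`: the buyers that an augmenting path connects to some item in `W`. -/
def connected (B : Set I) (U : Finset J) (M : Finset (I × J)) (W : Finset J) : Set I :=
  {i | ∃ j ∈ W, A.AugPath B U M i j}

/-! ### The ascending price auction -/

/-- `|𝓜(G^p)|` for the current budgets and the unsold items. -/
def sizeG [Fintype I] [Fintype J] (s : AuctionState I J) (p : ℝ) : ℕ :=
  A.matchNum s.budget p (A.buyers s.budget p) s.unsold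

/-- `|𝓜(Ḡ^p)|`: the same with the buyers in `A^p` only. -/
def sizeGbar [Fintype I] [Fintype J] (s : AuctionState I J) (p : ℝ) : ℕ :=
  A.matchNum s.budget p (A.buyersAbove s.budget p) s.unsold

/-- The price `p` is critical: a maximum matching is smaller at every slightly higher price. -/
def IsCritical [Fintype I] [Fintype J] (s : AuctionState I J) (p : ℝ) : Prop :=
  ∀ᶠ δ in 𝓝[>] (0 : ℝ), A.sizeG s (p + δ) < A.sizeG s p

/-- `J_Q^p`: the items in the preference-sets of the buyers in `Q^p`. -/
def itemsAt (β : I → ℝ) (p : ℝ) : Set J := {j | ∃ i ∈ A.buyersAt β p, j ∈ A.S i}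

/-- The possible return values `M` of Compute-Allocation-I at price `p`. First `M₀` is a maximum
matching of the buyers in `A^p` with the minimum number of items in `J_Q^p` matched. The buyers that
are connected to an unmatched item keep their items in `M₀`. The assignment `R` gives the unmatched
items to buyers in `Q^p` within their demands, as many of these items as possible. -/
def ComputeAllocationI (s : AuctionState I J) (p : ℝ) (M : Finset (I × J)) : Prop :=
  ∃ M₀ R : Finset (I × J),
    A.IsMaxMatching s.budget p (A.buyersAbove s.budget p) s.unsold M₀ ∧
    (∀ M₁, A.IsMaxMatching s.budget p (A.buyersAbove s.budget p) s.unsold M₁ →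
      (M₀.filter fun e => e.2 ∈ A.itemsAt s.budget p).card ≤
        (M₁.filter fun e => e.2 ∈ A.itemsAt s.budget p).card) ∧
    A.IsMaxMatching s.budget p (A.buyersAt s.budget p) (unmatched s.unsold M₀) R ∧
    M = (M₀.filter fun e =>
      e.1 ∈ A.connected (A.buyersAbove s.budget p) s.unsold M₀ (unmatched s.unsold M₀)) ∪ R

/-- The possible results of Compute-Allocation-II, where `q = p + ε` is the slightly higher price: the
returned assignment `M`, and the set `W` of items that it takes off the market. -/
def ComputeAllocationII (s : AuctionState I J) (q : ℝ) (M : Finset (I × J)) (W : Finset J) : Prop :=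
  ∃ M₀ : Finset (I × J),
    A.IsMaxMatching s.budget q (A.buyers s.budget q) s.unsold M₀ ∧
    W = unmatched s.unsold M₀ ∧
    M = M₀.filter fun e => e.1 ∈ A.connected (A.buyers s.budget q) s.unsold M₀ W

/-- The current price becomes `p`, and every edge `(i, j)` of `M` is sold at the price `q`. -/
def sell (s : AuctionState I J) (p q : ℝ) (M : Finset (I × J)) : AuctionState I J where
  price := p
  unsold := s.unsold \ M.image Prod.snd
  budget := fun i => s.budget i - ((M.filter fun e => e.1 = i).card : ℝ) * q
  outcome :=
    { X := fun i => s.outcome.X i ∪ (M.filter fun e => e.1 = i).image Prod.snd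
      pay := fun i => s.outcome.pay i + ((M.filter fun e => e.1 = i).card : ℝ) * q }

/-- Take the items in `W` off the market. -/
def discard (s : AuctionState I J) (W : Finset J) : AuctionState I J :=
  { s with unsold := s.unsold \ W }

/-- Take those items off the market that no buyer demands at price `q`. -/
def discardUndemanded (s : AuctionState I J) (q : ℝ) : AuctionState I J :=
  { s with unsold := s.unsold.filter fun j => ∃ i ∈ A.buyers s.budget q, j ∈ A.S i }

/-- The loop condition fails. -/
def Halted [Fintype I] [Fintype J] (s : AuctionState I J) : Prop := A.sizeG s s.price = 0

/-- One pass through the loop. The price is increased (possibly by nothing) to the first critical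
price `p`. If `|𝓜(G^p)| > |𝓜(Ḡ^p)|`, then Compute-Allocation-I is executed and its assignment is sold
at `p`. Otherwise Compute-Allocation-II is executed and its assignment is sold at `p + ε`. -/
inductive Step [Fintype I] [Fintype J] (ε : ℝ) : AuctionState I J → AuctionState I J → Prop
  | allocI {s : AuctionState I J} {p : ℝ} {M : Finset (I × J)} :
      ¬ A.Halted s → IsLeast {q | s.price ≤ q ∧ A.IsCritical s q} p →
      A.sizeGbar s p < A.sizeG s p → A.ComputeAllocationI s p M →
      Step ε s (sell s p p M)
  | allocII {s : AuctionState I J} {p : ℝ} {M : Finset (I × J)} {W : Finset J} :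
      ¬ A.Halted s → IsLeast {q | s.price ≤ q ∧ A.IsCritical s q} p →
      ¬ A.sizeGbar s p < A.sizeG s p → A.ComputeAllocationII s (p + ε) M W →
      Step ε s (A.discardUndemanded (discard (sell s p (p + ε) M) W) (p + ε))

/-- The initial state: price `0`, all items on sale, nothing sold. -/
def start [Fintype J] : AuctionState I J where
  price := 0
  unsold := Finset.univ
  budget := A.b
  outcome := { X := fun _ => ∅, pay := fun _ => 0 }

/-- Some run of the algorithm, from the initial state, passes through `s`. -/
def Reachable [Fintype I] [Fintype J] (ε : ℝ) (s : AuctionState I J) : Prop :=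
  Relation.ReflTransGen (A.Step ε) A.start s

/-- The algorithm terminates: no run is infinite, and no run gets stuck inside the loop. -/
def Terminates [Fintype I] [Fintype J] (ε : ℝ) : Prop :=
  Acc (fun t s => A.Step ε s t) A.start ∧
    ∀ s, A.Reachable ε s → ¬ A.Halted s → ∃ t, A.Step ε s t

/-- `o` is an outcome that a run of the algorithm returns (matchings may be chosen in several ways). -/
def IsOutput [Fintype I] [Fintype J] (ε : ℝ) (o : Outcome I J) : Prop :=
  ∃ s, A.Reachable ε s ∧ A.Halted s ∧ s.outcome = o

end Market

end MatchingMarkets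

/-! The bound is a charging argument. Call a buyer done if she has spent at least half of her budget
and cannot afford another item. In a feasible outcome she pays at most her budget, hence at most
twice her payment in the auction. A buyer who is not done pays at most her valuation for each item
of her preference-set in her bundle. So it suffices to give every item a value that is at least the
valuation of each interested buyer who is not done, with total value at most twice the auction
revenue. The two charges add up to the factor 4 (`Invariant.revenue_le`).

During the auction `Invariant` keeps a matching `L` on the items still in demand; only items outside
`L` are charged. A round replaces `L` by the edges of `M₀` at unconnected buyers, and items dropping
out of `L` receive the sale price as value. `Invariant.sale` reduces each round to two facts. (1) At
most two items drop out per item sold. By `AugPath.exists_larger` connected buyers are saturated in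
`M₀`, and by `IsMatching.mem_connected` an item not held by an unconnected buyer interests only
connected buyers of that graph. This bounds the matching number before the drop
(`card_le_of_isMaxMatching_buyersAbove`, `card_le_of_isMaxMatching_of_demand_le`). (2) Connected
buyers become done: their demand is limited by the budget, so after buying at least one item they
have less than the price of one item left.

How small `ε` must be depends only on the gaps of the finite set `A.breakpoints A.b`, which contains
every critical price that the auction meets (`Invariant.critical_mem_breakpoints`). -/

noncomputable section MatchingMarketProof

open scoped Classical

namespace Market

variable {I J : Type*} (A : Market I J)

/-! ### Matchings with arbitrary capacities -/

/-- A `B`-matching with capacity `d i` at every buyer `i`. -/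
structure IsCapMatching (B : Set I) (d : I → ℕ) (U : Finset J) (M : Finset (I × J)) : Prop where
  edge : ∀ e ∈ M, e.1 ∈ B ∧ e.2 ∈ U ∧ e.2 ∈ A.S e.1
  degree_le : ∀ i, (M.filter fun e => e.1 = i).card ≤ d i
  supply_le : ∀ j, (M.filter fun e => e.2 = j).card ≤ 1

variable {A}

theorem IsMatching.isCapMatching {β : I → ℝ} {p : ℝ} {B : Set I} {U : Finset J}
    {M : Finset (I × J)} (h : A.IsMatching β p B U M) :
    A.IsCapMatching B (A.demand β p) U M :=
  ⟨h.edge, h.demand_le, h.supply_le⟩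

theorem IsCapMatching.isMatching {β : I → ℝ} {p : ℝ} {B : Set I} {U : Finset J}
    {M : Finset (I × J)} (h : A.IsCapMatching B (A.demand β p) U M) :
    A.IsMatching β p B U M :=
  ⟨h.edge, h.degree_le, h.supply_le⟩

theorem IsCapMatching.eq_of_snd_eq {B : Set I} {d : I → ℕ} {U : Finset J} {M : Finset (I × J)}
    (h : A.IsCapMatching B d U M) {e e' : I × J} (he : e ∈ M) (he' : e' ∈ M)
    (hee : e.2 = e'.2) : e = e' :=
  Finset.card_le_one.1 (h.supply_le e'.2) e (by simp [he, hee]) e' (by simp [he'])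

theorem IsMatching.eq_of_snd_eq {β : I → ℝ} {p : ℝ} {B : Set I} {U : Finset J}
    {M : Finset (I × J)} (h : A.IsMatching β p B U M) {e e' : I × J} (he : e ∈ M) (he' : e' ∈ M)
    (hee : e.2 = e'.2) : e = e' :=
  h.isCapMatching.eq_of_snd_eq he he' hee

theorem IsMatching.card_image_snd {β : I → ℝ} {p : ℝ} {B : Set I} {U : Finset J}
    {M T : Finset (I × J)} (h : A.IsMatching β p B U M) (hT : T ⊆ M) :
    (T.image Prod.snd).card = T.card :=
  Finset.card_image_of_injOn fun _ he _ he' hee => h.eq_of_snd_eq (hT he) (hT he') hee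

theorem IsMatching.demand_pos {β : I → ℝ} {p : ℝ} {B : Set I} {U : Finset J}
    {M : Finset (I × J)} (h : A.IsMatching β p B U M) {e : I × J} (he : e ∈ M) :
    0 < A.demand β p e.1 :=
  lt_of_lt_of_le (Finset.card_pos.2 ⟨e, by simp [he]⟩) (h.demand_le e.1)

/-- Subsets of matchings are matchings, also for a smaller set of buyers or of items, and for
budgets and prices that do not decrease the demands of the buyers involved. -/
theorem IsMatching.of_subset {β β' : I → ℝ} {p p' : ℝ} {B B' : Set I} {U U' : Finset J}
    {M T : Finset (I × J)} (h : A.IsMatching β p B U M) (hT : T ⊆ M)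
    (hB : ∀ e ∈ T, e.1 ∈ B') (hU : ∀ e ∈ T, e.2 ∈ U')
    (hd : ∀ e ∈ T, A.demand β p e.1 ≤ A.demand β' p' e.1) : A.IsMatching β' p' B' U' T where
  edge e he := ⟨hB e he, hU e he, (h.edge e (hT he)).2.2⟩
  demand_le i := by
    rcases (T.filter fun e => e.1 = i).eq_empty_or_nonempty with h0 | ⟨e, he⟩
    · simp [h0]
    · rw [Finset.mem_filter] at he
      have := hd e he.1
      rw [he.2] at this
      exact (Finset.card_le_card (Finset.filter_subset_filter _ hT)).trans ((h.demand_le i).trans this)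
  supply_le j := (Finset.card_le_card (Finset.filter_subset_filter _ hT)).trans (h.supply_le j)

theorem isMatching_empty (β : I → ℝ) (p : ℝ) (B : Set I) (U : Finset J) :
    A.IsMatching β p B U ∅ := ⟨by simp, by simp, by simp⟩

/-! ### Augmenting paths -/

/-- An augmenting path to an unmatched item can be made to avoid a matched item, at the cost of
starting at its buyer. -/
theorem AugPath.avoid {B : Set I} {d : I → ℕ} {U : Finset J} {M : Finset (I × J)}
    (hM : A.IsCapMatching B d U M) {k : I} {z : J} (hkz : (k, z) ∈ M) {y : I} {j : J}
    (hj : j ∉ M.image Prod.snd) (h : A.AugPath B U M y j) :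
    A.AugPath B (U.erase z) (M.erase (k, z)) y j ∨
      A.AugPath B (U.erase z) (M.erase (k, z)) k j := by
  have hne : j ≠ z := by
    rintro rfl
    exact hj (Finset.mem_image.2 ⟨_, hkz, rfl⟩)
  induction h with
  | last hB hU hS hn =>
    exact Or.inl (.last hB (Finset.mem_erase.2 ⟨hne, hU⟩) hS fun h => hn (Finset.mem_of_mem_erase h))
  | @cons y y₂ z₁ j hB hU hS hn hm _ ih =>
    -- Only `k` holds `z`, so a path through `z` continues at `k`; what follows the last visit to
    -- `z` is the required path.
    by_cases hz : z₁ = z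
    · subst hz
      have : y₂ = k := congrArg Prod.fst (hM.eq_of_snd_eq hm hkz rfl)
      subst this
      exact Or.inr ((ih hj hne).elim id id)
    · rcases ih hj hne with h | h
      · refine Or.inl (.cons hB (Finset.mem_erase.2 ⟨hz, hU⟩) hS
          (fun h => hn (Finset.mem_of_mem_erase h)) (Finset.mem_erase.2 ⟨?_, hm⟩) h)
        intro h
        exact hz (congrArg Prod.snd h)
      · exact Or.inr h

/-- Undoes the reduction in `AugPath.exists_larger`, where `z` and one unit of the capacity of `i`
are set aside for each other. -/
theorem IsCapMatching.insert {B : Set I} {d : I → ℕ} {U : Finset J} {M : Finset (I × J)} {i : I}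
    {z : J} (hM : A.IsCapMatching B (Function.update d i (d i - 1)) (U.erase z) M) (hd : 0 < d i)
    (hB : i ∈ B) (hU : z ∈ U) (hS : z ∈ A.S i) :
    A.IsCapMatching B d U (insert (i, z) M) ∧ (insert (i, z) M).card = M.card + 1 := by
  have hz : ∀ e ∈ M, e.2 ≠ z := fun e he => Finset.ne_of_mem_erase (hM.edge e he).2.1
  refine ⟨⟨?_, ?_, ?_⟩, Finset.card_insert_of_notMem fun h => hz _ h rfl⟩
  · intro e he
    rcases Finset.mem_insert.1 he with rfl | he
    · exact ⟨hB, hU, hS⟩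
    · exact ⟨(hM.edge e he).1, Finset.mem_of_mem_erase (hM.edge e he).2.1, (hM.edge e he).2.2⟩
  · intro k
    have := hM.degree_le k
    rw [Finset.filter_insert]
    split_ifs with h
    · have h' : i = k := h
      subst h'
      rw [Function.update_self] at this
      exact (Finset.card_insert_le _ _).trans (by omega)
    · rwa [Function.update_of_ne (fun h' => h h'.symm)] at this
  · intro j
    rw [Finset.filter_insert]
    split_ifs with h
    · have h' : z = j := h
      subst h'
      rw [Finset.filter_eq_empty_iff.2 fun e he => hz e he]
      simp
    · exact hM.supply_le j

/-- A matching is not maximum if an augmenting path leads from an unsaturated buyer to an unmatched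
item. -/
theorem AugPath.exists_larger {B : Set I} {U : Finset J} : ∀ {d : I → ℕ} {M : Finset (I × J)}
    {i : I} {j : J}, A.IsCapMatching B d U M → (M.filter fun e => e.1 = i).card < d i →
    j ∉ M.image Prod.snd → A.AugPath B U M i j →
    ∃ M', A.IsCapMatching B d U M' ∧ M'.card = M.card + 1 := by
  -- The first edge `(i, z)` of the path takes `z` from its holder `k`. With `z` deleted, `k` is
  -- unsaturated and the rest of the path, rerouted around `z`, augments from `k`. One unit of
  -- capacity of `i` is reserved for `z`; hence arbitrary capacities instead of demands.
  induction U using Finset.strongInduction with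
  | H U ih =>
    intro d M i j hM hi hj h
    have key : ∀ {z : J} {T : Finset (I × J)}, T ⊆ M → (∀ e ∈ T, e.2 ≠ z) →
        A.IsCapMatching B (Function.update d i (d i - 1)) (U.erase z) T := by
      intro z T hT hz
      refine ⟨fun e he => ⟨(hM.edge e (hT he)).1, Finset.mem_erase.2
        ⟨hz e he, (hM.edge e (hT he)).2.1⟩, (hM.edge e (hT he)).2.2⟩, fun k => ?_, fun j =>
        (Finset.card_le_card (Finset.filter_subset_filter _ hT)).trans (hM.supply_le j)⟩
      refine (Finset.card_le_card (Finset.filter_subset_filter _ hT)).trans ?_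
      by_cases hk : k = i
      · subst hk
        rw [Function.update_self]
        omega
      · rw [Function.update_of_ne hk]
        exact hM.degree_le k
    cases h with
    | last hB hU hS hn =>
      refine ⟨_, IsCapMatching.insert (key subset_rfl ?_) (by omega) hB hU hS⟩
      rintro e he rfl
      exact hj (Finset.mem_image_of_mem _ he)
    | @cons _ k z _ hB hU hS hn hkz h =>
      have hki : k ≠ i := by
        rintro rfl
        exact hn hkz
      have hT : A.IsCapMatching B (Function.update d i (d i - 1)) (U.erase z) (M.erase (k, z)) := by
        refine key (Finset.erase_subset _ _) fun e he hez => ?_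
        exact Finset.ne_of_mem_erase he (hM.eq_of_snd_eq (Finset.mem_of_mem_erase he) hkz hez)
      obtain ⟨M', hM', hc⟩ := ih (U.erase z) (Finset.erase_ssubset hU) hT (i := k) (j := j) (by
          rw [Function.update_of_ne hki, Finset.filter_erase]
          have h1 := hM.degree_le k
          have h2 := Finset.card_erase_lt_of_mem
            (show (k, z) ∈ M.filter fun e => e.1 = k by simp [hkz])
          omega)
        (fun h => hj (Finset.image_subset_image (Finset.erase_subset _ _) h))
        ((h.avoid hM hkz hj).elim id id)
      have := IsCapMatching.insert hM' (by omega) hB hU hS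
      refine ⟨_, this.1, ?_⟩
      rw [this.2, hc, Finset.card_erase_add_one hkz]

section Connected

variable {β : I → ℝ} {p : ℝ} {B : Set I} {U : Finset J} {M : Finset (I × J)} {i : I}

theorem connected_subset {W : Finset J} : A.connected B U M W ⊆ B := by
  rintro i ⟨j, _, h⟩
  cases h <;> assumption

theorem IsMaxMatching.card_eq_demand (hM : A.IsMaxMatching β p B U M)
    (hi : i ∈ A.connected B U M (unmatched U M)) :
    (M.filter fun e => e.1 = i).card = A.demand β p i := by
  obtain ⟨j, hj, h⟩ := hi
  refine (hM.1.demand_le i).antisymm (not_lt.1 fun hlt => ?_)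
  obtain ⟨M', hM', hc⟩ := h.exists_larger hM.1.isCapMatching hlt (Finset.mem_sdiff.1 hj).2
  have := hM.2 M' hM'.isMatching
  omega

/-- The path starts with an item of `A.S i` that `i` does not hold, although she is saturated. So if
her demand is positive, it is her budget that limits it. -/
theorem IsMaxMatching.demand_lt_card (hM : A.IsMaxMatching β p B U M)
    (hi : i ∈ A.connected B U M (unmatched U M)) : A.demand β p i < (A.S i).card := by
  have hz : ∃ z ∈ A.S i, (i, z) ∉ M := by
    obtain ⟨j, _, h⟩ := hi
    cases h with
    | last _ _ hS hn => exact ⟨_, hS, hn⟩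
    | cons _ _ hS hn _ _ => exact ⟨_, hS, hn⟩
  obtain ⟨z, hS, hn⟩ := hz
  rw [← hM.card_eq_demand hi, ← hM.1.card_image_snd (Finset.filter_subset _ _)]
  refine Finset.card_lt_card (Finset.ssubset_iff_of_subset ?_ |>.2 ⟨z, hS, ?_⟩)
  · intro j hj
    obtain ⟨e, he, rfl⟩ := Finset.mem_image.1 hj
    rw [Finset.mem_filter] at he
    exact he.2 ▸ (hM.1.edge e he.1).2.2
  · intro hj
    obtain ⟨⟨k, z'⟩, he, h⟩ := Finset.mem_image.1 hj
    rw [Finset.mem_filter] at he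
    obtain ⟨he, h'⟩ := he
    simp only at h h'
    subst h h'
    exact hn he

/-- Buyers interested in an item that is not held by an unconnected buyer are connected. -/
theorem IsMatching.mem_connected (hM : A.IsMatching β p B U M) (hi : i ∈ B) {j : J} (hU : j ∈ U)
    (hS : j ∈ A.S i)
    (hj : j ∉ (M.filter fun e => e.1 ∉ A.connected B U M (unmatched U M)).image Prod.snd) :
    i ∈ A.connected B U M (unmatched U M) := by
  by_cases h : j ∈ M.image Prod.snd
  · obtain ⟨⟨k, j'⟩, hkj, h'⟩ := Finset.mem_image.1 h
    simp only at h'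
    subst h'
    have hk : k ∈ A.connected B U M (unmatched U M) := by
      by_contra hk
      exact hj (Finset.mem_image.2 ⟨(k, j'), by simp [hkj, hk], rfl⟩)
    by_cases hij : (i, j') ∈ M
    · have : i = k := congrArg Prod.fst (hM.eq_of_snd_eq hij hkj rfl)
      rwa [this]
    · obtain ⟨w, hw, hp⟩ := hk
      exact ⟨w, hw, .cons hi hU hS hij hkj hp⟩
  · exact ⟨j, Finset.mem_sdiff.2 ⟨hU, h⟩, .last hi hU hS fun h' =>
      h (Finset.mem_image.2 ⟨_, h', rfl⟩)⟩

end Connected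

/-! ### Maximum matchings -/

theorem IsMatching.card_filter_snd_mem_le {β : I → ℝ} {p : ℝ} {B : Set I}
    {U : Finset J} {M : Finset (I × J)} (hM : A.IsMatching β p B U M) (L : Finset J) :
    (M.filter fun e => e.2 ∈ L).card ≤ L.card := by
  rw [← hM.card_image_snd (Finset.filter_subset _ _)]
  refine Finset.card_le_card fun j hj => ?_
  obtain ⟨e, he, rfl⟩ := Finset.mem_image.1 hj
  exact (Finset.mem_filter.1 he).2

theorem card_filter_fst_mem [Fintype I] (M : Finset (I × J)) (N : Set I) :
    (M.filter fun e => e.1 ∈ N).card =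
      ∑ i with i ∈ N, (M.filter fun e => e.1 = i).card := by
  rw [Finset.card_eq_sum_card_fiberwise (f := Prod.fst) (t := Finset.univ.filter (· ∈ N))
    (fun e he => by simpa using (Finset.mem_filter.1 he).2)]
  refine Finset.sum_congr rfl fun i hi => ?_
  rw [Finset.filter_filter]
  congr 1
  ext e
  simp only [Finset.mem_filter, Finset.mem_univ, true_and] at hi ⊢
  constructor
  · rintro ⟨h, _, h'⟩
    exact ⟨h, h'⟩
  · rintro ⟨h, h'⟩
    exact ⟨h, h' ▸ hi, h'⟩

section MatchNum

variable [Fintype I] {β : I → ℝ} {p : ℝ} {B : Set I} {U : Finset J}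
  {M : Finset (I × J)}

theorem card_eq_sum_card_fst (M : Finset (I × J)) :
    M.card = ∑ i, (M.filter fun e => e.1 = i).card := by
  simpa using card_filter_fst_mem M Set.univ

theorem IsMaxMatching.card_filter_connected (hM : A.IsMaxMatching β p B U M) :
    (M.filter fun e => e.1 ∈ A.connected B U M (unmatched U M)).card =
      ∑ i with i ∈ A.connected B U M (unmatched U M), A.demand β p i := by
  rw [card_filter_fst_mem]
  exact Finset.sum_congr rfl fun i hi => hM.card_eq_demand (Finset.mem_filter.1 hi).2

theorem IsMatching.card_filter_fst_mem_le (hM : A.IsMatching β p B U M) (N : Set I) :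
    (M.filter fun e => e.1 ∈ N).card ≤ ∑ i with i ∈ N, A.demand β p i := by
  rw [card_filter_fst_mem]
  exact Finset.sum_le_sum fun i _ => hM.demand_le i

variable [Fintype J]

theorem IsMatching.card_le_matchNum (hM : A.IsMatching β p B U M) :
    M.card ≤ A.matchNum β p B U :=
  Finset.le_sup (f := Finset.card) (by simpa using hM)

theorem exists_isMatching_card_eq (A : Market I J) (β : I → ℝ) (p : ℝ) (B : Set I)
    (U : Finset J) : ∃ M, A.IsMatching β p B U M ∧ M.card = A.matchNum β p B U := by
  obtain ⟨M, hM, h⟩ := Finset.exists_mem_eq_sup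
    ((Finset.univ : Finset (Finset (I × J))).filter fun M => A.IsMatching β p B U M)
    ⟨∅, by simpa using isMatching_empty β p B U⟩ Finset.card
  exact ⟨M, by simpa using hM, h.symm⟩

theorem isMaxMatching_iff :
    A.IsMaxMatching β p B U M ↔ A.IsMatching β p B U M ∧ M.card = A.matchNum β p B U := by
  constructor
  · rintro ⟨h, hmax⟩
    obtain ⟨M', hM', hc⟩ := exists_isMatching_card_eq A β p B U
    exact ⟨h, h.card_le_matchNum.antisymm (hc ▸ hmax M' hM')⟩
  · rintro ⟨h, hc⟩
    exact ⟨h, fun M' hM' => hc ▸ hM'.card_le_matchNum⟩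

theorem exists_isMaxMatching (A : Market I J) (β : I → ℝ) (p : ℝ) (B : Set I)
    (U : Finset J) : ∃ M, A.IsMaxMatching β p B U M := by
  obtain ⟨M, hM⟩ := exists_isMatching_card_eq A β p B U
  exact ⟨M, isMaxMatching_iff.2 hM⟩

end MatchNum

/-! ### Demands -/

section Demand

variable {β : I → ℝ} {p q : ℝ} {i : I}

/-- The price 0 is a separate case because `β i` may be negative here; `k = 0` is excluded because
it satisfies the left side even above the valuation. -/
theorem le_demand_iff (hp : 0 ≤ p) {k : ℕ} (hk : k ≠ 0) :
    k ≤ A.demand β p i ↔ p ≤ A.v i ∧ k ≤ (A.S i).card ∧ (p = 0 ∨ k * p ≤ β i) := by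
  unfold demand
  split_ifs with h1 h2
  · subst h2
    simp [h1]
  · have : 0 < p := lt_of_le_of_ne hp (Ne.symm h2)
    rw [le_min_iff, Nat.le_floor_iff' hk, le_div_iff₀ this]
    simp only [h1, h2, true_and, false_or]
    exact and_comm
  · simp [h1, hk]

theorem demand_pos_iff (hp : 0 ≤ p) :
    0 < A.demand β p i ↔ p ≤ A.v i ∧ 0 < (A.S i).card ∧ (p = 0 ∨ p ≤ β i) := by
  have := le_demand_iff (A := A) (β := β) (i := i) hp one_ne_zero
  simpa [Nat.one_le_iff_ne_zero, Nat.pos_iff_ne_zero] using this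

theorem demand_antitone (hp : 0 ≤ p) (hpq : p ≤ q) : A.demand β q i ≤ A.demand β p i := by
  by_cases hk : A.demand β q i = 0
  · simp [hk]
  · obtain ⟨h1, h2, h3⟩ := (le_demand_iff (hp.trans hpq) hk).1 le_rfl
    refine (le_demand_iff hp hk).2 ⟨hpq.trans h1, h2, ?_⟩
    rcases h3 with rfl | h3
    · exact Or.inl (le_antisymm hpq hp)
    · exact Or.inr ((mul_le_mul_of_nonneg_left hpq (Nat.cast_nonneg _)).trans h3)

theorem mem_buyers_iff : i ∈ A.buyers β p ↔ 0 < A.demand β p i := by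
  constructor
  · rintro (h | h)
    exacts [h.2, h.2]
  · intro h
    have hv : p ≤ A.v i := by
      by_contra hv
      simp [demand, hv] at h
    rcases hv.lt_or_eq with hv | hv
    · exact Or.inl ⟨hv, h⟩
    · exact Or.inr ⟨hv.symm, h⟩

/-- The prices at which the demand of some buyer may drop. -/
def breakpoints (A : Market I J) (β : I → ℝ) : Set ℝ :=
  insert 0 (Set.range A.v ∪ ⋃ i, (fun k : ℕ => β i / k) '' Set.Iic (A.S i).card)

theorem finite_breakpoints [Finite I] (A : Market I J) (β : I → ℝ) :
    (A.breakpoints β).Finite :=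
  ((Set.finite_range _).union
    (Set.finite_iUnion fun _ => (Set.finite_Iic _).image _)).insert _

theorem zero_mem_breakpoints : 0 ∈ A.breakpoints β := Or.inl rfl

theorem v_mem_breakpoints (i : I) : A.v i ∈ A.breakpoints β := Or.inr (Or.inl ⟨i, rfl⟩)

theorem div_mem_breakpoints {k : ℕ} (hk : k ≤ (A.S i).card) : β i / k ∈ A.breakpoints β :=
  Or.inr (Or.inr (Set.mem_iUnion.2 ⟨i, k, hk, rfl⟩))

/-- The hypothesis `h` says that no breakpoint lies in `[p, q)`. The budgets need to agree only at
`i`, so that initial budgets can replace current ones buyer by buyer. -/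
theorem demand_eq_of_breakpoints {β' : I → ℝ} (hβ : β' i = β i) (hp : 0 ≤ p) (hpq : p ≤ q)
    (h : ∀ c ∈ A.breakpoints β', p ≤ c → q ≤ c) : A.demand β p i = A.demand β q i := by
  refine le_antisymm ?_ (demand_antitone hp hpq)
  by_cases hk : A.demand β p i = 0
  · simp [hk]
  · obtain ⟨h1, h2, h3⟩ := (le_demand_iff hp hk).1 le_rfl
    refine (le_demand_iff (hp.trans hpq) hk).2 ⟨h _ (v_mem_breakpoints i) h1, h2, ?_⟩
    have hk' : (0 : ℝ) < A.demand β p i := by exact_mod_cast Nat.pos_of_ne_zero hk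
    rcases h3 with rfl | h3
    · exact Or.inl (le_antisymm (h 0 zero_mem_breakpoints le_rfl) hpq)
    · have := h _ (div_mem_breakpoints h2) (by rw [le_div_iff₀ hk', hβ]; linarith)
      rw [le_div_iff₀ hk', hβ] at this
      exact Or.inr (by linarith)

end Demand

/-! ### Critical prices -/

section Critical

variable [Fintype I] [Fintype J] {s : AuctionState I J} {p q : ℝ}

theorem sizeG_le_of_demand_le (h : ∀ i, A.demand s.budget p i ≤ A.demand s.budget q i) :
    A.sizeG s p ≤ A.sizeG s q := by
  obtain ⟨M, hM, hc⟩ := exists_isMatching_card_eq A s.budget p (A.buyers s.budget p) s.unsold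
  unfold sizeG
  rw [← hc]
  exact (hM.of_subset subset_rfl
    (fun e he => mem_buyers_iff.2 ((hM.demand_pos he).trans_le (h e.1)))
    (fun e he => (hM.edge e he).2.1) fun e _ => h e.1).card_le_matchNum

theorem sizeG_antitone (hp : 0 ≤ p) (hpq : p ≤ q) : A.sizeG s q ≤ A.sizeG s p :=
  sizeG_le_of_demand_le fun _ => demand_antitone hp hpq

theorem sizeG_congr (h : ∀ i, A.demand s.budget p i = A.demand s.budget q i) :
    A.sizeG s p = A.sizeG s q :=
  (sizeG_le_of_demand_le fun i => (h i).le).antisymm (sizeG_le_of_demand_le fun i => (h i).ge)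

/-- The last price at which the matching number still has its value at `p` is critical. -/
theorem exists_isCritical (hp : 0 ≤ p) (hpq : p ≤ q) (h : A.sizeG s q < A.sizeG s p) :
    ∃ c, p ≤ c ∧ c < q ∧ A.IsCritical s c := by
  set T : Set ℝ := {x | p ≤ x ∧ A.sizeG s x = A.sizeG s p} with hT
  have hpT : p ∈ T := ⟨le_rfl, rfl⟩
  have hub : ∀ x ∈ T, x ≤ q := by
    intro x hx
    by_contra hlt
    have := sizeG_antitone (A := A) (s := s) (hp.trans hpq) (not_le.1 hlt).le
    rw [hx.2] at this
    omega
  have hbdd : BddAbove T := ⟨q, hub⟩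
  set c := sSup T with hc
  have hpc : p ≤ c := le_csSup hbdd hpT
  have hcT : A.sizeG s c = A.sizeG s p := by
    -- The supremum is attained because demands are left-continuous: just below `c` there are no
    -- breakpoints.
    have hev : ∀ᶠ y in 𝓝[<] c, ∀ x ∈ A.breakpoints s.budget, x < c → x < y := by
      refine ((finite_breakpoints A s.budget).eventually_all).2 fun x _ => ?_
      by_cases hx : x < c
      · filter_upwards [Ioo_mem_nhdsLT hx] with y hy _ using hy.1
      · exact Eventually.of_forall fun y h => absurd h hx
    obtain ⟨y, hy, hyc⟩ := (hev.and self_mem_nhdsWithin).exists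
    obtain ⟨x, hxT, hyx⟩ := exists_lt_of_lt_csSup ⟨p, hpT⟩ hyc
    rw [← hxT.2]
    refine (sizeG_congr fun i => demand_eq_of_breakpoints rfl (hp.trans hxT.1)
      (le_csSup hbdd hxT) fun z hz hxz => not_lt.1 fun hzc => ?_).symm
    exact absurd (hy z hz hzc) (not_lt.2 (hyx.le.trans hxz))
  have hcq : c ≤ q := csSup_le ⟨p, hpT⟩ hub
  refine ⟨c, hpc, hcq.lt_of_ne fun h' => ?_, ?_⟩
  · rw [h'] at hcT
    omega
  · refine eventually_nhdsWithin_of_forall fun δ hδ => ?_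
    have hδ' : c < c + δ := lt_add_of_pos_right c hδ
    refine (sizeG_antitone (hp.trans hpc) hδ'.le).lt_of_ne fun h' => ?_
    exact absurd (le_csSup hbdd (show c + δ ∈ T from ⟨hpc.trans hδ'.le, h'.trans hcT⟩))
      (not_le.2 hδ')

/-- If `p` were not in `C`, an interval to the right of `p` would avoid `C`, and the demands would
be constant there. Leaving `C` free allows both current and initial breakpoints. -/
theorem IsCritical.mem_of_finite (h : A.IsCritical s p) {C : Set ℝ} (hC : C.Finite)
    (hdem : ∀ q, p ≤ q → (∀ c ∈ C, p ≤ c → q ≤ c) →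
      ∀ i, A.demand s.budget p i = A.demand s.budget q i) : p ∈ C := by
  by_contra hpC
  have hev : ∀ᶠ δ in 𝓝[>] (0 : ℝ), ∀ c ∈ C, p ≤ c → p + δ ≤ c := by
    refine hC.eventually_all.2 fun c hc => ?_
    by_cases hpc : p ≤ c
    · have : 0 < c - p := sub_pos.2 (hpc.lt_of_ne fun h => hpC (h ▸ hc))
      filter_upwards [Ioo_mem_nhdsGT this] with δ hδ _
      linarith [hδ.2]
    · exact Eventually.of_forall fun δ h => absurd h hpc
  obtain ⟨δ, ⟨h1, h2⟩, h3⟩ := ((h.and hev).and self_mem_nhdsWithin).exists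
  have h3' : (0 : ℝ) < δ := h3
  exact h1.ne (sizeG_congr (hdem _ (by linarith) h2)).symm

theorem IsCritical.sizeG_lt (h : A.IsCritical s p) (hp : 0 ≤ p) (hpq : p < q) :
    A.sizeG s q < A.sizeG s p := by
  obtain ⟨δ, h1, h2⟩ := (h.and (Ioo_mem_nhdsGT (sub_pos.2 hpq))).exists
  exact (sizeG_antitone (by linarith [h2.1]) (by linarith [h2.2])).trans_lt h1

/-- A drop before `p` would produce an earlier critical price. -/
theorem sizeG_eq_of_isLeast (hs : 0 ≤ s.price)
    (h : IsLeast {q | s.price ≤ q ∧ A.IsCritical s q} p) :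
    A.sizeG s p = A.sizeG s s.price := by
  refine (sizeG_antitone hs h.1.1).antisymm (not_lt.1 fun hlt => ?_)
  obtain ⟨c, h1, h2, h3⟩ := exists_isCritical hs h.1.1 hlt
  exact absurd (h.2 ⟨h1, h3⟩) (not_le.2 h2)

theorem exists_isLeast_isCritical (hs : 0 ≤ s.price) (h : ¬ A.Halted s) :
    ∃ p, IsLeast {q | s.price ≤ q ∧ A.IsCritical s q} p := by
  have hfin : {q | s.price ≤ q ∧ A.IsCritical s q}.Finite := by
    refine (finite_breakpoints A s.budget).subset fun q hq => ?_
    exact hq.2.mem_of_finite (finite_breakpoints A s.budget) fun q' hqq' hc i =>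
      demand_eq_of_breakpoints rfl (hs.trans hq.1) hqq' hc
  have hne : {q | s.price ≤ q ∧ A.IsCritical s q}.Nonempty := by
    obtain ⟨q, hq⟩ := (Set.finite_range A.v).bddAbove
    have hv : ∀ i, A.v i < max s.price (q + 1) := fun i =>
      lt_of_lt_of_le (by linarith [hq ⟨i, rfl⟩]) (le_max_right _ _)
    have h0 : A.sizeG s (max s.price (q + 1)) = 0 := by
      obtain ⟨M, hM, hc⟩ := exists_isMatching_card_eq A s.budget (max s.price (q + 1))
        (A.buyers s.budget (max s.price (q + 1))) s.unsold
      unfold sizeG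
      rw [← hc, Finset.card_eq_zero, Finset.eq_empty_iff_forall_notMem]
      intro e he
      have := hM.demand_pos he
      simp [demand, not_le.2 (hv e.1)] at this
    obtain ⟨c, h1, _, h3⟩ := exists_isCritical (A := A) (s := s) hs (le_max_left _ (q + 1))
      (by rw [h0]; exact Nat.pos_of_ne_zero h)
    exact ⟨c, h1, h3⟩
  obtain ⟨p, hp, hmin⟩ := hfin.exists_minimalFor id _ hne
  exact ⟨p, hp, fun q hq => (le_total p q).elim id fun h => hmin hq h⟩

end Critical

/-! ### Comparing the matchings before and after a drop of the demands -/

section Counting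

variable [Fintype I] {β : I → ℝ} {p q : ℝ} {U : Finset J} {P M₀ R : Finset (I × J)}

/-- The three terms bound the edges of `P` at items matched in `M₀`, at connected buyers (saturated
in `M₀`), and between unmatched items and buyers with valuation `p`. Nothing else is left, since a
buyer above `p` interested in an unmatched item is connected. -/
theorem card_le_of_isMaxMatching_buyersAbove
    (hM₀ : A.IsMaxMatching β p (A.buyersAbove β p) U M₀)
    (hR : A.IsMaxMatching β p (A.buyersAt β p) (unmatched U M₀) R)
    (hP : A.IsMatching β p (A.buyers β p) U P) :
    P.card ≤ M₀.card +
      (M₀.filter fun e => e.1 ∈ A.connected (A.buyersAbove β p) U M₀ (unmatched U M₀)).card +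
      R.card := by
  set N := A.connected (A.buyersAbove β p) U M₀ (unmatched U M₀) with hN
  have h1 : (P.filter fun e => e.2 ∈ M₀.image Prod.snd).card ≤ M₀.card :=
    (hP.card_filter_snd_mem_le _).trans Finset.card_image_le
  have h2 : (P.filter fun e => e.1 ∈ N).card ≤ (M₀.filter fun e => e.1 ∈ N).card :=
    (hP.card_filter_fst_mem_le N).trans_eq hM₀.card_filter_connected.symm
  have h3 : (P.filter fun e => e.2 ∉ M₀.image Prod.snd ∧ e.1 ∈ A.buyersAt β p).card ≤ R.card := by
    refine hR.2 _ (hP.of_subset (Finset.filter_subset _ _) ?_ ?_ fun _ _ => le_rfl)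
    · exact fun e he => (Finset.mem_filter.1 he).2.2
    · exact fun e he => Finset.mem_sdiff.2
        ⟨(hP.edge e (Finset.mem_filter.1 he).1).2.1, (Finset.mem_filter.1 he).2.1⟩
  have h4 : P ⊆ (P.filter fun e => e.2 ∈ M₀.image Prod.snd) ∪ (P.filter fun e => e.1 ∈ N) ∪
      (P.filter fun e => e.2 ∉ M₀.image Prod.snd ∧ e.1 ∈ A.buyersAt β p) := by
    intro e he
    obtain ⟨hB, hU, hS⟩ := hP.edge e he
    by_cases h : e.2 ∈ M₀.image Prod.snd
    · exact Finset.mem_union_left _ (Finset.mem_union_left _ (Finset.mem_filter.2 ⟨he, h⟩))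
    · rcases hB with hB | hB
      · refine Finset.mem_union_left _ (Finset.mem_union_right _ (Finset.mem_filter.2 ⟨he, ?_⟩))
        exact hM₀.1.mem_connected hB hU hS fun h' =>
          h (Finset.image_subset_image (Finset.filter_subset _ _) h')
      · exact Finset.mem_union_right _ (Finset.mem_filter.2 ⟨he, h, hB⟩)
  have h5 := Finset.card_le_card h4
  have h6 := Finset.card_union_le ((P.filter fun e => e.2 ∈ M₀.image Prod.snd) ∪
    (P.filter fun e => e.1 ∈ N))
    (P.filter fun e => e.2 ∉ M₀.image Prod.snd ∧ e.1 ∈ A.buyersAt β p)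
  have h7 := Finset.card_union_le (P.filter fun e => e.2 ∈ M₀.image Prod.snd)
    (P.filter fun e => e.1 ∈ N)
  omega

/-- An edge of `P` uses an item held by an unconnected buyer or belongs to a connected buyer.
Connected buyers have at most twice as many edges in `P` as in `M₀`, which counts their part of `M₀`
once more. -/
theorem card_le_of_isMaxMatching_of_demand_le
    (hM₀ : A.IsMaxMatching β q (A.buyers β q) U M₀)
    (hP : A.IsMatching β p (A.buyersAbove β p) U P)
    (hB : ∀ e ∈ P, e.1 ∈ A.buyers β q)
    (hd : ∀ i ∈ A.connected (A.buyers β q) U M₀ (unmatched U M₀),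
      A.demand β p i ≤ 2 * A.demand β q i) :
    P.card ≤ M₀.card +
      (M₀.filter fun e => e.1 ∈ A.connected (A.buyers β q) U M₀ (unmatched U M₀)).card := by
  set N := A.connected (A.buyers β q) U M₀ (unmatched U M₀) with hN
  have h1 : (P.filter fun e => e.2 ∈ (M₀.filter fun e => e.1 ∉ N).image Prod.snd).card ≤
      (M₀.filter fun e => e.1 ∉ N).card :=
    (hP.card_filter_snd_mem_le _).trans Finset.card_image_le
  have h2 : (P.filter fun e => e.1 ∈ N).card ≤ 2 * (M₀.filter fun e => e.1 ∈ N).card := by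
    rw [hM₀.card_filter_connected, Finset.mul_sum]
    exact (hP.card_filter_fst_mem_le N).trans
      (Finset.sum_le_sum fun i hi => hd i (Finset.mem_filter.1 hi).2)
  have h4 : P ⊆ (P.filter fun e => e.2 ∈ (M₀.filter fun e => e.1 ∉ N).image Prod.snd) ∪
      (P.filter fun e => e.1 ∈ N) := by
    intro e he
    obtain ⟨_, hU, hS⟩ := hP.edge e he
    by_cases h : e.2 ∈ (M₀.filter fun e => e.1 ∉ N).image Prod.snd
    · exact Finset.mem_union_left _ (Finset.mem_filter.2 ⟨he, h⟩)
    · exact Finset.mem_union_right _ (Finset.mem_filter.2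
        ⟨he, hM₀.1.mem_connected (hB e he) hU hS h⟩)
  have h5 := (Finset.card_le_card h4).trans (Finset.card_union_le _ _)
  have h6 := Finset.card_filter_add_card_filter_not (s := M₀) fun e => e.1 ∈ N
  omega

end Counting

/-! ### Termination -/

section Termination

theorem ComputeAllocationI.mem_unsold {s : AuctionState I J} {p : ℝ} {M : Finset (I × J)}
    (h : A.ComputeAllocationI s p M) {e : I × J} (he : e ∈ M) : e.2 ∈ s.unsold := by
  obtain ⟨M₀, R, hM₀, _, hR, rfl⟩ := h
  rcases Finset.mem_union.1 he with he | he
  · exact (hM₀.1.edge e (Finset.mem_filter.1 he).1).2.1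
  · exact (Finset.mem_sdiff.1 (hR.1.edge e he).2.1).1

theorem mem_unsold_discardUndemanded {s : AuctionState I J} {q : ℝ} {j : J} :
    j ∈ (A.discardUndemanded s q).unsold ↔
      j ∈ s.unsold ∧ ∃ i ∈ A.buyers s.budget q, j ∈ A.S i :=
  Finset.mem_filter

variable [Fintype I] [Fintype J] {s t : AuctionState I J} {ε : ℝ}

theorem ComputeAllocationI.nonempty {p : ℝ} {M : Finset (I × J)}
    (h : A.ComputeAllocationI s p M) (hlt : A.sizeGbar s p < A.sizeG s p) : M.Nonempty := by
  obtain ⟨M₀, R, hM₀, _, hR, rfl⟩ := h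
  obtain ⟨P, hP, hc⟩ := exists_isMatching_card_eq A s.budget p (A.buyers s.budget p) s.unsold
  have h1 := card_le_of_isMaxMatching_buyersAbove hM₀ hR hP
  have h2 := (isMaxMatching_iff.1 hM₀).2
  unfold sizeG sizeGbar at hlt
  refine Finset.nonempty_iff_ne_empty.2 fun h => ?_
  rw [Finset.union_eq_empty] at h
  rw [h.1, h.2] at h1
  simp only [Finset.card_empty] at h1
  omega

theorem Step.price_le (h : A.Step ε s t) : s.price ≤ t.price := by
  cases h with
  | allocI _ hp _ _ => exact hp.1.1
  | allocII _ hp _ _ => exact hp.1.1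

/-- The first kind of round sells something. In the second, `M₀` is smaller than a maximum matching
at the critical price, so some item is unmatched and is discarded. -/
theorem Step.card_unsold_lt (hε : 0 < ε) (hs : 0 ≤ s.price) (h : A.Step ε s t) :
    t.unsold.card < s.unsold.card := by
  cases h with
  | allocI _ hp hlt hM =>
    obtain ⟨e, he⟩ := hM.nonempty hlt
    refine Finset.card_lt_card (Finset.ssubset_iff_of_subset Finset.sdiff_subset |>.2
      ⟨e.2, hM.mem_unsold he, fun h => ?_⟩)
    exact (Finset.mem_sdiff.1 h).2 (Finset.mem_image_of_mem _ he)
  | @allocII p M W _ hp hle hM =>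
    obtain ⟨M₀, hM₀, rfl, rfl⟩ := hM
    have hp0 : 0 ≤ p := hs.trans hp.1.1
    have h1 : M₀.card < A.sizeG s p := by
      rw [(isMaxMatching_iff.1 hM₀).2]
      exact hp.1.2.sizeG_lt hp0 (by linarith)
    have h2 : A.sizeG s p ≤ s.unsold.card := by
      obtain ⟨P, hP, hc⟩ := exists_isMatching_card_eq A s.budget p (A.buyers s.budget p) s.unsold
      unfold sizeG
      rw [← hc, ← hP.card_image_snd subset_rfl]
      exact Finset.card_le_card (Finset.image_subset_iff.2 fun e he => (hP.edge e he).2.1)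
    have h3 : (unmatched s.unsold M₀).Nonempty := by
      refine Finset.card_pos.1 ?_
      have := Finset.le_card_sdiff (M₀.image Prod.snd) s.unsold
      have h4 := Finset.card_image_le (s := M₀) (f := Prod.snd)
      unfold unmatched
      omega
    obtain ⟨j, hj⟩ := h3
    refine Finset.card_lt_card (Finset.ssubset_iff_of_subset ?_ |>.2
      ⟨j, (Finset.mem_sdiff.1 hj).1, fun h => ?_⟩)
    · exact fun z hz => (Finset.sdiff_subset.trans Finset.sdiff_subset)
        (mem_unsold_discardUndemanded.1 hz).1
    · exact (Finset.mem_sdiff.1 (mem_unsold_discardUndemanded.1 h).1).2 hj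

theorem Step.acc (hε : 0 < ε) : ∀ s : AuctionState I J, 0 ≤ s.price →
    Acc (fun t s => A.Step ε s t) s := by
  intro s
  induction hn : s.unsold.card using Nat.strong_induction_on generalizing s with
  | _ n ih =>
    intro hs
    refine Acc.intro _ fun t ht => ?_
    exact ih _ (hn ▸ ht.card_unsold_lt hε hs) t rfl (hs.trans ht.price_le)

theorem Reachable.price_nonneg (h : A.Reachable ε s) : 0 ≤ s.price := by
  induction h with
  | refl => exact le_rfl
  | tail _ h ih => exact ih.trans h.price_le

theorem exists_computeAllocationI (A : Market I J) (s : AuctionState I J) (p : ℝ) :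
    ∃ M, A.ComputeAllocationI s p M := by
  have hne : {M | A.IsMaxMatching s.budget p (A.buyersAbove s.budget p) s.unsold M}.Nonempty :=
    exists_isMaxMatching A _ _ _ _
  obtain ⟨M₀, hM₀, hmin⟩ := (Set.toFinite _).exists_minimalFor
    (fun M : Finset (I × J) => (M.filter fun e => e.2 ∈ A.itemsAt s.budget p).card) _ hne
  obtain ⟨R, hR⟩ := exists_isMaxMatching A s.budget p (A.buyersAt s.budget p)
    (unmatched s.unsold M₀)
  exact ⟨_, M₀, R, hM₀, fun M₁ hM₁ => (le_total _ _).elim id fun h => hmin hM₁ h, hR, rfl⟩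

theorem exists_step (hs : 0 ≤ s.price) (h : ¬ A.Halted s) : ∃ t, A.Step ε s t := by
  obtain ⟨p, hp⟩ := exists_isLeast_isCritical hs h
  by_cases hlt : A.sizeGbar s p < A.sizeG s p
  · obtain ⟨M, hM⟩ := exists_computeAllocationI A s p
    exact ⟨_, .allocI h hp hlt hM⟩
  · obtain ⟨M₀, hM₀⟩ := exists_isMaxMatching A s.budget (p + ε) (A.buyers s.budget (p + ε)) s.unsold
    exact ⟨_, .allocII h hp hlt ⟨M₀, hM₀, rfl, rfl⟩⟩

theorem terminates (A : Market I J) (hε : 0 < ε) : A.Terminates ε :=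
  ⟨Step.acc hε _ le_rfl, fun _ hs h => exists_step hs.price_nonneg h⟩

end Termination

/-! ### The invariant of the auction -/

/-- The buyer `i` has spent at least half of her budget, and cannot afford another item. -/
def Done (A : Market I J) (s : AuctionState I J) (i : I) : Prop :=
  0 ≤ s.budget i ∧ s.budget i < s.price ∧ A.b i ≤ 2 * s.outcome.pay i

/-- The invariant of the auction. The items matched in `L` are those still in demand. Every other
item `j` carries a value `val j` that is covered by the payments, and that is at least the valuation
of every interested buyer who is not done. -/
structure Invariant [Fintype I] [Fintype J] (A : Market I J) (s : AuctionState I J)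
    (L : Finset (I × J)) (val : J → ℝ) : Prop where
  price_nonneg : 0 ≤ s.price
  fresh : ∀ i, s.budget i = A.b i ∨ A.v i ≤ s.price ∨ A.Done s i
  pay_nonneg : ∀ i, 0 ≤ s.outcome.pay i
  live : A.IsMatching s.budget s.price (A.buyersAbove s.budget s.price) s.unsold L
  val_nonneg : ∀ j, 0 ≤ val j
  val_sum : ∑ j ∈ (L.image Prod.snd)ᶜ, val j ≤ 2 * s.outcome.revenue
  cover : ∀ i, ∀ j ∈ A.S i, A.Done s i ∨ j ∈ L.image Prod.snd ∨
    (A.v i ≤ val j ∧ (j ∉ s.unsold ∨ A.v i < s.price))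

theorem Done.demand_eq_zero {s : AuctionState I J} {i : I} (h : A.Done s i) {p : ℝ}
    (hp : s.price ≤ p) : A.demand s.budget p i = 0 := by
  obtain ⟨h1, h2, _⟩ := h
  by_contra hne
  rcases ((demand_pos_iff (by linarith)).1 (Nat.pos_of_ne_zero hne)).2.2 with h | h <;> linarith

theorem budget_lt_of_demand_lt {β : I → ℝ} {p : ℝ} {i : I} (hp : 0 ≤ p) (hv : p ≤ A.v i)
    (h : A.demand β p i < (A.S i).card) : β i < (A.demand β p i + 1) * p := by
  by_contra hlt
  have := (le_demand_iff (A := A) (β := β) (i := i) hp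
    (Nat.succ_ne_zero (A.demand β p i))).2 ⟨hv, h, Or.inr ?_⟩
  · omega
  · push_cast
    exact not_lt.1 hlt

theorem demand_mul_le {β : I → ℝ} {p : ℝ} {i : I} (hp : 0 ≤ p) (h : 0 < A.demand β p i)
    (hβ : 0 ≤ β i) : A.demand β p i * p ≤ β i := by
  rcases ((le_demand_iff hp h.ne').1 le_rfl).2.2 with rfl | h
  · simpa using hβ
  · exact h

namespace Invariant

variable [Fintype I] [Fintype J] {s t : AuctionState I J} {L : Finset (I × J)} {val : J → ℝ}
  {p q ε : ℝ}

/-- This is the purpose of the last alternative in `cover`: an item outside `L` is gone, or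
interests only buyers who are done or priced out. -/
theorem image_subset (h : A.Invariant s L val) (hp : s.price ≤ p) {B : Set I}
    {P : Finset (I × J)} (hP : A.IsMatching s.budget p B s.unsold P) :
    P.image Prod.snd ⊆ L.image Prod.snd := by
  refine Finset.image_subset_iff.2 fun e he => ?_
  have hd := hP.demand_pos he
  obtain ⟨_, hU, hS⟩ := hP.edge e he
  rcases h.cover e.1 e.2 hS with h1 | h1 | ⟨_, h1 | h1⟩
  · exact absurd (h1.demand_eq_zero hp) hd.ne'
  · exact h1
  · exact absurd hU h1
  · have := ((demand_pos_iff (h.price_nonneg.trans hp)).1 hd).1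
    linarith

theorem card_le_sizeG (h : A.Invariant s L val) : L.card ≤ A.sizeG s s.price :=
  (h.live.of_subset subset_rfl (fun e he => Or.inl (h.live.edge e he).1)
    (fun e he => (h.live.edge e he).2.1) fun _ _ => le_rfl).card_le_matchNum

theorem sizeG_le_card (h : A.Invariant s L val) (hp : s.price ≤ p) : A.sizeG s p ≤ L.card := by
  obtain ⟨P, hP, hc⟩ := exists_isMatching_card_eq A s.budget p (A.buyers s.budget p) s.unsold
  unfold sizeG
  rw [← hc, ← hP.card_image_snd subset_rfl, ← h.live.card_image_snd subset_rfl]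
  exact Finset.card_le_card (h.image_subset hp hP)

theorem budget_eq (h : A.Invariant s L val) {i : I} (hi : ¬ A.Done s i)
    (hv : s.price < A.v i) : s.budget i = A.b i :=
  (h.fresh i).elim id fun h' => (h'.elim (fun h'' => absurd hv (not_lt.2 h'')) fun h'' =>
    absurd h'' hi)

/-- Here budgets at least as large as valuations matter: an untouched budget pays for one item at
every price up to the valuation. -/
theorem demand_pos (h : A.Invariant s L val) (hb : ∀ i, A.v i ≤ A.b i) {i : I} {j : J}
    (hi : ¬ A.Done s i) (hv : s.price < A.v i) (hp : 0 ≤ p) (hpv : p ≤ A.v i) (hj : j ∈ A.S i) :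
    0 < A.demand s.budget p i := by
  refine (demand_pos_iff hp).2 ⟨hpv, Finset.card_pos.2 ⟨j, hj⟩, Or.inr ?_⟩
  rw [h.budget_eq hi hv]
  exact hpv.trans (hb i)

/-- By `fresh`, a buyer whose budget has changed is done, with no demand left, or has a valuation
not above the current price, so that only this valuation can be a breakpoint from now on. Hence
initial budgets suffice, and one `ε` serves the whole run. -/
theorem critical_mem_breakpoints (h : A.Invariant s L val) (hp : s.price ≤ p)
    (hc : A.IsCritical s p) : p ∈ A.breakpoints A.b := by
  have hp0 := h.price_nonneg.trans hp
  refine hc.mem_of_finite (finite_breakpoints A A.b) fun q hpq hq i => ?_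
  rcases h.fresh i with h1 | h1 | h1
  · exact demand_eq_of_breakpoints h1.symm hp0 hpq hq
  · by_cases hv : p ≤ A.v i
    · rw [le_antisymm hpq ((hq _ (v_mem_breakpoints i) hv).trans (h1.trans hp))]
    · simp [demand, hv, not_le.2 ((not_le.1 hv).trans_le hpq)]
  · rw [h1.demand_eq_zero hp, h1.demand_eq_zero (hp.trans hpq)]

/-! ### Preservation of the invariant by sales -/

/-- Selling the edges of `T` at the price `q` keeps the invariant if the items that are no longer in
demand number at most twice the items sold. -/
theorem sale (h : A.Invariant s L val) {T L' : Finset (I × J)} (hp : s.price ≤ t.price)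
    (hq : 0 ≤ q) (hunsold : t.unsold ⊆ s.unsold)
    (hbudget : ∀ i, t.budget i = s.budget i - ((T.filter fun e => e.1 = i).card : ℝ) * q)
    (hpay : ∀ i, t.outcome.pay i =
      s.outcome.pay i + ((T.filter fun e => e.1 = i).card : ℝ) * q)
    (hT : ∀ e ∈ T, ¬ A.Done s e.1) (hT' : ∀ e ∈ T, A.Done t e.1 ∨ A.v e.1 ≤ t.price)
    (hL' : A.IsMatching t.budget t.price (A.buyersAbove t.budget t.price) t.unsold L')
    (hsub : L'.image Prod.snd ⊆ L.image Prod.snd)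
    (hcard : L.card ≤ L'.card + 2 * T.card)
    (hcover : ∀ i, ∀ j ∈ A.S i, j ∈ L.image Prod.snd → j ∉ L'.image Prod.snd → ¬ A.Done t i →
      A.v i ≤ q ∧ (j ∉ t.unsold ∨ A.v i < t.price)) :
    A.Invariant t L' fun j => if j ∈ L.image Prod.snd then q else val j := by
  have hfix : ∀ i, (∀ e ∈ T, e.1 ≠ i) →
      t.budget i = s.budget i ∧ t.outcome.pay i = s.outcome.pay i := by
    intro i hi
    rw [hbudget, hpay, Finset.filter_eq_empty_iff.2 fun e he => hi e he]
    simp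
  have hdone : ∀ i, A.Done s i → A.Done t i := by
    intro i hi
    obtain ⟨h1, h2⟩ := hfix i fun e he hei => hT e he (hei ▸ hi)
    exact ⟨h1 ▸ hi.1, h1 ▸ hi.2.1.trans_le hp, h2 ▸ hi.2.2⟩
  refine ⟨h.price_nonneg.trans hp, fun i => ?_, fun i => ?_, hL', fun j => ?_, ?_, ?_⟩
  · by_cases hi : ∃ e ∈ T, e.1 = i
    · obtain ⟨e, he, rfl⟩ := hi
      exact Or.inr (hT' e he).symm
    · push Not at hi
      rw [(hfix i hi).1]
      rcases h.fresh i with h1 | h1 | h1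
      · exact Or.inl h1
      · exact Or.inr (Or.inl (h1.trans hp))
      · exact Or.inr (Or.inr (hdone i h1))
  · rw [hpay]
    have := h.pay_nonneg i
    positivity
  · split_ifs
    exacts [hq, h.val_nonneg j]
  · have hrev : t.outcome.revenue = s.outcome.revenue + T.card * q := by
      unfold Outcome.revenue
      simp only [hpay, Finset.sum_add_distrib, ← Finset.sum_mul]
      rw [card_eq_sum_card_fst T]
      push_cast
      rfl
    -- Only items leaving `L` are newly charged, each with `q`. Items of `L'` also get the value
    -- `q`, but are outside the sum.
    have hsplit : (L'.image Prod.snd)ᶜ =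
        (L.image Prod.snd)ᶜ ∪ (L.image Prod.snd \ L'.image Prod.snd) := by
      ext j
      have := @hsub j
      simp only [Finset.mem_compl, Finset.mem_union, Finset.mem_sdiff]
      tauto
    have hdisj : Disjoint (L.image Prod.snd)ᶜ (L.image Prod.snd \ L'.image Prod.snd) :=
      Finset.disjoint_left.2 fun j h1 h2 =>
        Finset.mem_compl.1 h1 (Finset.mem_sdiff.1 h2).1
    rw [hsplit, Finset.sum_union hdisj,
      Finset.sum_congr rfl (g := val) fun j hj => if_neg (Finset.mem_compl.1 hj),
      Finset.sum_congr (s₁ := L.image Prod.snd \ L'.image Prod.snd) rfl (g := fun _ => q)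
        fun j hj => if_pos (Finset.mem_sdiff.1 hj).1,
      Finset.sum_const, nsmul_eq_mul, hrev]
    have h1 : (L.image Prod.snd \ L'.image Prod.snd).card ≤ 2 * T.card := by
      rw [Finset.card_sdiff_of_subset hsub, h.live.card_image_snd subset_rfl,
        hL'.card_image_snd subset_rfl]
      omega
    have h2 : ((L.image Prod.snd \ L'.image Prod.snd).card : ℝ) * q ≤ 2 * T.card * q :=
      mul_le_mul_of_nonneg_right (by exact_mod_cast h1) hq
    have h3 := h.val_sum
    linarith
  · intro i j hj
    by_cases hi : A.Done t i
    · exact Or.inl hi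
    by_cases hj' : j ∈ L'.image Prod.snd
    · exact Or.inr (Or.inl hj')
    refine Or.inr (Or.inr ?_)
    by_cases hjL : j ∈ L.image Prod.snd
    · simpa only [if_pos hjL] using hcover i j hj hjL hj' hi
    · simp only [if_neg hjL]
      rcases h.cover i j hj with h1 | h1 | ⟨h1, h2⟩
      · exact absurd (hdone i h1) hi
      · exact absurd h1 hjL
      · exact ⟨h1, h2.imp (fun h h' => h (hunsold h')) fun h => h.trans_le hp⟩

/-- The leftover is below the price, which is at most `q ≤ k * q`; so the payment exceeds the
leftover and is at least half of the budget. -/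
theorem done_of_sale (h : A.Invariant s L val) {i : I} (hi : s.budget i = A.b i) {k : ℕ}
    (hk : 0 < k) (hpq : t.price ≤ q) (hq : 0 ≤ q) (hbudget : t.budget i = s.budget i - k * q)
    (hpay : t.outcome.pay i = s.outcome.pay i + k * q) (h0 : 0 ≤ A.b i - k * q)
    (hlt : A.b i - k * q < t.price) : A.Done t i := by
  have h1 := h.pay_nonneg i
  have h2 : q ≤ k * q := le_mul_of_one_le_left hq (by exact_mod_cast hk)
  refine ⟨by rw [hbudget, hi]; exact h0, by rw [hbudget, hi]; exact hlt, ?_⟩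
  rw [hpay]
  linarith

theorem allocI (h : A.Invariant s L val) (hb : ∀ i, A.v i ≤ A.b i) {M : Finset (I × J)}
    (hp : IsLeast {q | s.price ≤ q ∧ A.IsCritical s q} p) (hlt : A.sizeGbar s p < A.sizeG s p)
    (hM : A.ComputeAllocationI s p M) : ∃ L' val', A.Invariant (sell s p p M) L' val' := by
  obtain ⟨M₀, R, hM₀, _, hR, rfl⟩ := hM
  -- At the current price, `L` itself is a maximum matching and uses only buyers above the price, so
  -- the two matching numbers agree there.
  have hsp : s.price < p := by
    refine hp.1.1.lt_of_ne ?_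
    rintro rfl
    have h1 : L.card ≤ A.sizeGbar s s.price := h.live.card_le_matchNum
    have h2 := h.sizeG_le_card le_rfl
    omega
  have hp0 : 0 ≤ p := h.price_nonneg.trans hsp.le
  set N := A.connected (A.buyersAbove s.budget p) s.unsold M₀ (unmatched s.unsold M₀) with hN
  set T := (M₀.filter fun e => e.1 ∈ N) ∪ R with hT
  have hNA : ∀ i ∈ N, i ∈ A.buyersAbove s.budget p := fun i hi => connected_subset hi
  have hRQ : ∀ e ∈ R, A.v e.1 = p := fun e he => (hR.1.edge e he).1.1
  have hTdem : ∀ e ∈ T, 0 < A.demand s.budget p e.1 := by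
    intro e he
    rcases Finset.mem_union.1 he with he | he
    · exact hM₀.1.demand_pos (Finset.mem_filter.1 he).1
    · exact hR.1.demand_pos he
  have hnd : ∀ i, 0 < A.demand s.budget p i → ¬ A.Done s i := fun i hi hd =>
    hi.ne' (hd.demand_eq_zero hsp.le)
  have hbud : ∀ i, 0 < A.demand s.budget p i → s.budget i = A.b i := fun i hi =>
    h.budget_eq (hnd i hi) (hsp.trans_le ((demand_pos_iff hp0).1 hi).1)
  have hfiber : ∀ i ∈ N, (T.filter fun e => e.1 = i) = M₀.filter fun e => e.1 = i := by
    intro i hi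
    ext e
    simp only [hT, Finset.mem_filter, Finset.mem_union]
    constructor
    · rintro ⟨⟨h1, _⟩ | h1, rfl⟩
      · exact ⟨h1, rfl⟩
      · exact absurd (hRQ e h1) (hNA _ hi).1.ne'
    · rintro ⟨h1, rfl⟩
      exact ⟨Or.inl ⟨h1, hi⟩, rfl⟩
  have hfiber' : ∀ i, A.v i = p → (T.filter fun e => e.1 = i) = R.filter fun e => e.1 = i := by
    intro i hi
    ext e
    simp only [hT, Finset.mem_filter, Finset.mem_union]
    constructor
    · rintro ⟨⟨_, h1⟩ | h1, rfl⟩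
      · exact absurd hi (hNA _ h1).1.ne'
      · exact ⟨h1, rfl⟩
    · rintro ⟨h1, rfl⟩
      exact ⟨Or.inr h1, rfl⟩
  have hsat : ∀ i, 0 < A.demand s.budget p i → A.demand s.budget p i < (A.S i).card →
      (T.filter fun e => e.1 = i).card = A.demand s.budget p i → A.Done (sell s p p T) i := by
    intro i hi hc hk
    have h1 := budget_lt_of_demand_lt hp0 ((demand_pos_iff hp0).1 hi).1 hc
    have h2 := demand_mul_le hp0 hi (by rw [hbud i hi]; exact A.b_nonneg i)
    rw [hbud i hi] at h1 h2
    rw [← hk] at hi h1 h2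
    refine h.done_of_sale (hbud i (hk ▸ hi)) hi le_rfl hp0 rfl rfl (sub_nonneg.2 h2) ?_
    change A.b i - _ * p < p
    linarith
  have hdoneN : ∀ i ∈ N, A.Done (sell s p p T) i := fun i hi =>
    hsat i (hNA i hi).2 (hM₀.demand_lt_card hi) (by rw [hfiber i hi, hM₀.card_eq_demand hi])
  have himg : (M₀.filter fun e => e.1 ∉ N).image Prod.snd ⊆ L.image Prod.snd :=
    (Finset.image_subset_image (Finset.filter_subset _ _)).trans (h.image_subset hsp.le hM₀.1)
  refine ⟨M₀.filter fun e => e.1 ∉ N, _, h.sale (T := T) (q := p) hsp.le hp0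
    Finset.sdiff_subset (fun _ => rfl) (fun _ => rfl) (fun e he => hnd _ (hTdem e he)) ?_ ?_ himg
    ?_ ?_⟩
  · intro e he
    rcases Finset.mem_union.1 he with he | he
    · exact Or.inl (hdoneN _ (Finset.mem_filter.1 he).2)
    · exact Or.inr (hRQ e he).le
  · have hsame : ∀ e ∈ M₀.filter fun e => e.1 ∉ N,
        A.demand (sell s p p T).budget p e.1 = A.demand s.budget p e.1 := by
      intro e he
      rw [Finset.mem_filter] at he
      have : (T.filter fun e' => e'.1 = e.1) = ∅ := by
        refine Finset.filter_eq_empty_iff.2 fun e' he' hee => ?_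
        rcases Finset.mem_union.1 he' with he' | he'
        · exact he.2 (hee ▸ (Finset.mem_filter.1 he').2)
        · exact (hM₀.1.edge e he.1).1.1.ne' (hee ▸ hRQ e' he')
      simp [demand, sell, this]
    refine hM₀.1.of_subset (Finset.filter_subset _ _) ?_ ?_ fun e he => (hsame e he).ge
    · intro e he
      refine ⟨(hM₀.1.edge e (Finset.mem_filter.1 he).1).1.1, ?_⟩
      change 0 < A.demand _ p _
      rw [hsame e he]
      exact hM₀.1.demand_pos (Finset.mem_filter.1 he).1
    · intro e he
      rw [Finset.mem_filter] at he
      refine Finset.mem_sdiff.2 ⟨(hM₀.1.edge e he.1).2.1, fun hmem => ?_⟩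
      obtain ⟨e', he', hee⟩ := Finset.mem_image.1 hmem
      rcases Finset.mem_union.1 he' with he' | he'
      · rw [Finset.mem_filter] at he'
        exact he.2 (hM₀.1.eq_of_snd_eq he'.1 he.1 hee ▸ he'.2)
      · exact (Finset.mem_sdiff.1 (hR.1.edge e' he').2.1).2
          (hee ▸ Finset.mem_image_of_mem _ he.1)
  -- No drop occurs before `p`, so `L` is at most as large as `P`. In the bound for `P`, connected
  -- edges of `M₀` count twice and edges of `R` once.
  · obtain ⟨P, hP, hc⟩ := exists_isMatching_card_eq A s.budget p (A.buyers s.budget p) s.unsold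
    have h1 := card_le_of_isMaxMatching_buyersAbove hM₀ hR hP
    rw [← hN] at h1
    have h2 := h.card_le_sizeG
    rw [← sizeG_eq_of_isLeast h.price_nonneg hp] at h2
    unfold sizeG at h2
    have h3 := Finset.card_filter_add_card_filter_not (s := M₀) fun e => e.1 ∈ N
    have h4 : T.card = (M₀.filter fun e => e.1 ∈ N).card + R.card := by
      refine Finset.card_union_of_disjoint (Finset.disjoint_left.2 fun e he he' => ?_)
      exact (Finset.mem_sdiff.1 (hR.1.edge e he').2.1).2
        (Finset.mem_image_of_mem _ (Finset.mem_filter.1 he).1)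
    omega
  · intro i j hj hjL hj' hi
    have hjU : j ∈ s.unsold := by
      obtain ⟨e, he, rfl⟩ := Finset.mem_image.1 hjL
      exact (h.live.edge e he).2.1
    have hiN : i ∉ N := fun hiN => hi (hdoneN i hiN)
    have hdem : p ≤ A.v i → 0 < A.demand s.budget p i := by
      intro hv
      refine h.demand_pos hb (fun hd => ?_) (hsp.trans_le hv) hp0 hv hj
      have hTi : (T.filter fun e => e.1 = i) = ∅ :=
        Finset.filter_eq_empty_iff.2 fun e he hei => hnd _ (hTdem e he) (hei ▸ hd)
      refine hi ⟨?_, ?_, ?_⟩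
      · simpa [sell, hTi] using hd.1
      · simpa [sell, hTi] using hd.2.1.trans hsp
      · simpa [sell, hTi] using hd.2.2
    have hle : A.v i ≤ p := not_lt.1 fun hv =>
      hiN (hM₀.1.mem_connected ⟨hv, hdem hv.le⟩ hjU hj hj')
    refine ⟨hle, ?_⟩
    -- The remaining case is `A.v i = p` with `j` still unsold. Then `R` leaves `j` unassigned, so
    -- its maximality forces `i` to be saturated, hence done.
    by_contra hcon
    push Not at hcon
    obtain ⟨hjt, hv⟩ := hcon
    have hv : A.v i = p := le_antisymm hle hv
    have hjT : j ∉ T.image Prod.snd := (Finset.mem_sdiff.1 hjt).2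
    have hjR : j ∉ R.image Prod.snd := fun h' =>
      hjT (Finset.image_subset_image Finset.subset_union_right h')
    have hjM : j ∈ unmatched s.unsold M₀ := by
      refine Finset.mem_sdiff.2 ⟨hjU, fun h' => ?_⟩
      obtain ⟨e, he, rfl⟩ := Finset.mem_image.1 h'
      by_cases heN : e.1 ∈ N
      · exact hjT (Finset.mem_image_of_mem _
          (Finset.mem_union_left _ (Finset.mem_filter.2 ⟨he, heN⟩)))
      · exact hj' (Finset.mem_image_of_mem _ (Finset.mem_filter.2 ⟨he, heN⟩))
    have hiQ : i ∈ A.buyersAt s.budget p := ⟨hv, hdem hv.ge⟩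
    have hijR : (i, j) ∉ R := fun h' => hjR (Finset.mem_image_of_mem _ h')
    have hconn : i ∈ A.connected (A.buyersAt s.budget p) (unmatched s.unsold M₀) R
        (unmatched (unmatched s.unsold M₀) R) :=
      ⟨j, Finset.mem_sdiff.2 ⟨hjM, hjR⟩, .last hiQ hjM hj hijR⟩
    exact hi (hsat i hiQ.2 (hR.demand_lt_card hconn)
      (by rw [hfiber' i hv, hR.card_eq_demand hconn]))

theorem allocII (h : A.Invariant s L val) (hb : ∀ i, A.v i ≤ A.b i) {M : Finset (I × J)}
    {W : Finset J} (hε : 0 < ε)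
    (hgap : ∀ c ∈ A.breakpoints A.b, ∀ c' ∈ A.breakpoints A.b, c < c' → c + ε < c')
    (hp : IsLeast {q | s.price ≤ q ∧ A.IsCritical s q} p)
    (hle : ¬ A.sizeGbar s p < A.sizeG s p) (hM : A.ComputeAllocationII s (p + ε) M W) :
    ∃ L' val', A.Invariant
      (A.discardUndemanded (discard (sell s p (p + ε) M) W) (p + ε)) L' val' := by
  obtain ⟨M₀, hM₀, rfl, rfl⟩ := hM
  have hsp : s.price ≤ p := hp.1.1
  have hp0 : 0 ≤ p := h.price_nonneg.trans hsp
  have hpC := h.critical_mem_breakpoints hsp hp.1.2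
  obtain ⟨q, hq⟩ : ∃ q, p + ε = q := ⟨_, rfl⟩
  rw [hq] at hM₀ ⊢
  have hpq : p < q := by linarith
  have hq0 : 0 ≤ q := hp0.trans hpq.le
  -- The critical price `p` is itself a breakpoint, so no breakpoint lies in `(p, p + ε]`.
  have hgap' : ∀ c ∈ A.breakpoints A.b, c ≤ q → c ≤ p := by
    intro c hc hcq
    by_contra hlt
    have := hgap p hpC c hc (not_le.1 hlt)
    linarith
  set N := A.connected (A.buyers s.budget q) s.unsold M₀ (unmatched s.unsold M₀) with hN
  set T := M₀.filter fun e => e.1 ∈ N with hT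
  set t := A.discardUndemanded (discard (sell s p q T) (unmatched s.unsold M₀)) q with ht
  have htbud : ∀ i, t.budget i = s.budget i - ((T.filter fun e => e.1 = i).card : ℝ) * q :=
    fun _ => rfl
  have hunsold : ∀ j, j ∈ t.unsold ↔ ((j ∈ s.unsold ∧ j ∉ T.image Prod.snd) ∧
      j ∉ unmatched s.unsold M₀) ∧ ∃ i ∈ A.buyers t.budget q, j ∈ A.S i := by
    intro j
    rw [ht, mem_unsold_discardUndemanded]
    simp only [discard, sell, Finset.mem_sdiff]
    rfl
  have hnd : ∀ i, 0 < A.demand s.budget q i → ¬ A.Done s i := fun i hi hd =>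
    hi.ne' (hd.demand_eq_zero (hsp.trans hpq.le))
  have hv : ∀ i, 0 < A.demand s.budget q i → p < A.v i := fun i hi =>
    hpq.trans_le ((demand_pos_iff hq0).1 hi).1
  have hbud : ∀ i, 0 < A.demand s.budget q i → s.budget i = A.b i := fun i hi =>
    h.budget_eq (hnd i hi) (hsp.trans_lt (hv i hi))
  have hNB : ∀ i ∈ N, 0 < A.demand s.budget q i := fun i hi =>
    mem_buyers_iff.1 (connected_subset hi)
  have hB : ∀ i, ¬ A.Done s i → p < A.v i → ∀ j ∈ A.S i, i ∈ A.buyers s.budget q := by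
    intro i hi hpv j hj
    refine mem_buyers_iff.2 (h.demand_pos hb hi (hsp.trans_lt hpv) hq0 ?_ hj)
    by_contra hlt
    exact absurd hpv (not_lt.2 (hgap' _ (v_mem_breakpoints i) (not_le.1 hlt).le))
  have hfiber : ∀ i ∈ N, (T.filter fun e => e.1 = i) = M₀.filter fun e => e.1 = i := by
    intro i hi
    ext e
    simp only [hT, Finset.mem_filter]
    constructor
    · rintro ⟨⟨h1, _⟩, rfl⟩
      exact ⟨h1, rfl⟩
    · rintro ⟨h1, rfl⟩
      exact ⟨⟨h1, hi⟩, rfl⟩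
  -- One item more is unaffordable at `q`; the threshold `b i / (D_i(q) + 1)` is a breakpoint below
  -- `q`, hence at most `p`.
  have hbound : ∀ i ∈ N, A.b i ≤ (A.demand s.budget q i + 1) * p := by
    intro i hi
    have h1 := hNB i hi
    have h2 := budget_lt_of_demand_lt hq0 ((demand_pos_iff hq0).1 h1).1 (hM₀.demand_lt_card hi)
    rw [hbud i h1] at h2
    have hpos : (0 : ℝ) < A.demand s.budget q i + 1 := by positivity
    have h3 := hgap' _ (div_mem_breakpoints (A := A) (β := A.b) (i := i)
      (k := A.demand s.budget q i + 1) (hM₀.demand_lt_card hi))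
    push_cast at h3
    rw [div_le_iff₀ hpos, div_le_iff₀ hpos] at h3
    linarith [h3 (by linarith)]
  have hdoneN : ∀ i ∈ N, A.Done t i := by
    intro i hi
    have h1 := hNB i hi
    have h2 := demand_mul_le hq0 h1 (by rw [hbud i h1]; exact A.b_nonneg i)
    have h3 := hbound i hi
    have hk : (T.filter fun e => e.1 = i).card = A.demand s.budget q i := by
      rw [hfiber i hi, hM₀.card_eq_demand hi]
    have hbi := hbud i h1
    rw [hbi] at h2
    rw [← hk] at h1 h2 h3
    refine h.done_of_sale hbi h1 hpq.le hq0 rfl rfl (sub_nonneg.2 h2) ?_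
    -- The new state has price `p`, not `q`, so the leftover must be below `p`; `hbound` is sharp
    -- enough for this.
    change _ < p
    have h4 : ((T.filter fun e => e.1 = i).card : ℝ) * p <
        ((T.filter fun e => e.1 = i).card : ℝ) * q :=
      mul_lt_mul_of_pos_left hpq (by exact_mod_cast h1)
    linarith
  have hTN : ∀ e ∈ T, e.1 ∈ N := fun e he => (Finset.mem_filter.1 he).2
  have himg : (M₀.filter fun e => e.1 ∉ N).image Prod.snd ⊆ L.image Prod.snd :=
    (Finset.image_subset_image (Finset.filter_subset _ _)).trans
      (h.image_subset (hsp.trans hpq.le) hM₀.1)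
  refine ⟨M₀.filter fun e => e.1 ∉ N, _, h.sale (T := T) (q := q) hsp hq0
    (fun j hj => ((hunsold j).1 hj).1.1.1) htbud (fun _ => rfl)
    (fun e he => hnd _ (hNB _ (hTN e he))) (fun e he => Or.inl (hdoneN _ (hTN e he))) ?_ himg
    ?_ ?_⟩
  · have hsame : ∀ e ∈ M₀.filter fun e => e.1 ∉ N, ∀ x,
        A.demand t.budget x e.1 = A.demand s.budget x e.1 := by
      intro e he x
      have : (T.filter fun e' => e'.1 = e.1) = ∅ :=
        Finset.filter_eq_empty_iff.2 fun e' he' hee =>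
          (Finset.mem_filter.1 he).2 (hee ▸ hTN e' he')
      simp [demand, htbud, this]
    have hle : ∀ e ∈ M₀.filter fun e => e.1 ∉ N,
        A.demand s.budget q e.1 ≤ A.demand t.budget t.price e.1 := by
      intro e he
      rw [hsame e he]
      exact demand_antitone hp0 hpq.le
    refine hM₀.1.of_subset (Finset.filter_subset _ _) ?_ ?_ hle
    · intro e he
      have hd := hM₀.1.demand_pos (Finset.mem_filter.1 he).1
      exact ⟨hv _ hd, hd.trans_le (hle e he)⟩
    · intro e he
      have he' := he
      rw [Finset.mem_filter] at he'
      obtain ⟨_, hU, hS⟩ := hM₀.1.edge e he'.1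
      refine (hunsold _).2 ⟨⟨⟨hU, fun hmem => ?_⟩, fun hmem =>
        (Finset.mem_sdiff.1 hmem).2 (Finset.mem_image_of_mem _ he'.1)⟩, e.1, ?_, hS⟩
      · obtain ⟨e', he'', hee⟩ := Finset.mem_image.1 hmem
        exact he'.2 (hM₀.1.eq_of_snd_eq (Finset.mem_filter.1 he'').1 he'.1 hee ▸ hTN e' he'')
      · rw [mem_buyers_iff, hsame e he]
        exact hM₀.1.demand_pos he'.1
  · obtain ⟨P, hP, hc⟩ :=
      exists_isMatching_card_eq A s.budget p (A.buyersAbove s.budget p) s.unsold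
    have h1 := card_le_of_isMaxMatching_of_demand_le hM₀ hP ?_ ?_
    · rw [← hN, ← hT] at h1
      have h2 := h.card_le_sizeG
      rw [← sizeG_eq_of_isLeast h.price_nonneg hp] at h2
      have h3 := Finset.card_filter_add_card_filter_not (s := M₀) fun e => e.1 ∈ N
      rw [← hT] at h3
      unfold sizeGbar at hle
      omega
    · intro e he
      obtain ⟨hA, _, hS⟩ := hP.edge e he
      exact hB _ (fun hd => hA.2.ne' (hd.demand_eq_zero hsp)) hA.1 _ hS
    · intro i hi
      have h1 := hNB i hi
      -- A demand that falls by at most one and stays positive is at most halved.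
      suffices A.demand s.budget p i ≤ A.demand s.budget q i + 1 by omega
      by_contra hlt
      obtain ⟨_, _, h2⟩ := (le_demand_iff hp0 (Nat.succ_ne_zero _)).1
        (Nat.succ_le_of_lt (not_le.1 hlt))
      have h3 := hbound i hi
      have h4 : 0 < A.b i := (A.v_pos i).trans_le (hb i)
      rcases h2 with rfl | h2
      · linarith
      · rw [hbud i h1] at h2
        push_cast at h2
        have h5 : p ≤ 0 := by linarith
        rw [le_antisymm h5 hp0] at h3
        linarith
  · intro i j hj hjL hj' hi
    have hjU : j ∈ s.unsold := by
      obtain ⟨e, he, rfl⟩ := Finset.mem_image.1 hjL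
      exact (h.live.edge e he).2.1
    have hiN : i ∉ N := fun hiN => hi (hdoneN i hiN)
    have hds : ¬ A.Done s i := by
      intro hd
      have hTi : (T.filter fun e => e.1 = i) = ∅ :=
        Finset.filter_eq_empty_iff.2 fun e he hei => hnd _ (hNB _ (hTN e he)) (hei ▸ hd)
      refine hi ⟨?_, ?_, ?_⟩
      · simpa [htbud, hTi] using hd.1
      · rw [htbud, hTi]
        change _ < p
        simpa using hd.2.1.trans_le hsp
      · change _ ≤ 2 * (s.outcome.pay i + ((T.filter fun e => e.1 = i).card : ℝ) * q)
        simpa [hTi] using hd.2.2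
    have hle : A.v i ≤ p := not_lt.1 fun hpv =>
      hiN (hM₀.1.mem_connected (hB i hds hpv j hj) hjU hj hj')
    -- Every unmatched item has been discarded and every item of a connected buyer sold, so all
    -- unsold items are matched in the new `L`.
    refine ⟨hle.trans hpq.le, Or.inl fun hjt => ?_⟩
    obtain ⟨⟨⟨_, h1⟩, h2⟩, _⟩ := (hunsold j).1 hjt
    refine h2 (Finset.mem_sdiff.2 ⟨hjU, fun h' => ?_⟩)
    obtain ⟨e, he, rfl⟩ := Finset.mem_image.1 h'
    by_cases heN : e.1 ∈ N
    · exact h1 (Finset.mem_image_of_mem _ (Finset.mem_filter.2 ⟨he, heN⟩))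
    · exact hj' (Finset.mem_image_of_mem _ (Finset.mem_filter.2 ⟨he, heN⟩))

/-! ### The invariant along a run, and the revenue bound -/

theorem start (A : Market I J) : ∃ L val, A.Invariant A.start L val := by
  have hch : ∀ j : {j // ∃ i, j ∈ A.S i}, ∃ i, j.1 ∈ A.S i := fun j => j.2
  choose f hf using hch
  -- At price 0 the demand is the size of the preference-set, so each wanted item can go to an
  -- arbitrary interested buyer.
  set L : Finset (I × J) := Finset.univ.image fun j : {j // ∃ i, j ∈ A.S i} => (f j, j.1) with hL
  have hS : ∀ e ∈ L, e.2 ∈ A.S e.1 := by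
    intro e he
    obtain ⟨j, _, rfl⟩ := Finset.mem_image.1 he
    exact hf j
  have hd : ∀ i, A.demand A.b 0 i = (A.S i).card := fun i => by simp [demand, (A.v_pos i).le]
  have hinj : ∀ e ∈ L, ∀ e' ∈ L, e.2 = e'.2 → e = e' := by
    intro e he e' he' hee
    obtain ⟨j, _, rfl⟩ := Finset.mem_image.1 he
    obtain ⟨j', _, rfl⟩ := Finset.mem_image.1 he'
    have : j = j' := Subtype.ext hee
    rw [this]
  have hcov : ∀ i, ∀ j ∈ A.S i, j ∈ L.image Prod.snd := fun i j hj =>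
    Finset.mem_image.2 ⟨(f ⟨j, i, hj⟩, j), Finset.mem_image.2 ⟨⟨j, i, hj⟩, Finset.mem_univ _, rfl⟩,
      rfl⟩
  refine ⟨L, fun _ => 0, le_rfl, fun i => Or.inl rfl, fun _ => le_rfl, ⟨?_, ?_, ?_⟩,
    fun _ => le_rfl, ?_, fun i j hj => Or.inr (Or.inl (hcov i j hj))⟩
  · intro e he
    refine ⟨⟨A.v_pos _, ?_⟩, Finset.mem_univ _, hS e he⟩
    change 0 < A.demand A.b 0 e.1
    rw [hd]
    exact Finset.card_pos.2 ⟨_, hS e he⟩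
  · intro i
    change _ ≤ A.demand A.b 0 i
    rw [hd, ← Finset.card_image_of_injOn (f := Prod.snd)]
    · refine Finset.card_le_card fun j hj => ?_
      obtain ⟨e, he, rfl⟩ := Finset.mem_image.1 hj
      rw [Finset.mem_filter] at he
      exact he.2 ▸ hS e he.1
    · intro e he e' he' hee
      exact hinj e (Finset.mem_filter.1 he).1 e' (Finset.mem_filter.1 he').1 hee
  · refine fun j => Finset.card_le_one.2 fun e he e' he' => ?_
    rw [Finset.mem_filter] at he he'
    exact hinj e he.1 e' he'.1 (he.2.trans he'.2.symm)
  · simp [Outcome.revenue, Market.start]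

theorem of_reachable (hb : ∀ i, A.v i ≤ A.b i) (hε : 0 < ε)
    (hgap : ∀ c ∈ A.breakpoints A.b, ∀ c' ∈ A.breakpoints A.b, c < c' → c + ε < c')
    (hs : A.Reachable ε s) : ∃ L val, A.Invariant s L val := by
  induction hs with
  | refl => exact start A
  | tail _ hstep ih =>
    obtain ⟨L, val, h⟩ := ih
    cases hstep with
    | allocI _ hp hlt hM => exact h.allocI hb hp hlt hM
    | allocII _ hp hle hM => exact h.allocII hb hε hgap hp hle hM

/-- At the end `L` is empty and all items are charged. Done buyers are compared through their
budgets, the others through the values of their disjoint bundles; each part contributes at most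
twice the revenue. -/
theorem revenue_le (h : A.Invariant s L val) (hs : A.Halted s) {o : Outcome I J}
    (ho : A.IsFeasible o) : o.revenue ≤ 4 * s.outcome.revenue := by
  have hL : L = ∅ := Finset.card_eq_zero.1 (Nat.le_zero.1 (h.card_le_sizeG.trans_eq hs))
  subst hL
  have hi : ∀ i, o.pay i ≤ 2 * s.outcome.pay i + ∑ j ∈ o.X i, val j := by
    intro i
    have hsum : 0 ≤ ∑ j ∈ o.X i, val j := Finset.sum_nonneg fun j _ => h.val_nonneg j
    have hpay := h.pay_nonneg i
    have hr := ho.rational i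
    unfold utility at hr
    split_ifs at hr with hbi
    · by_cases hd : A.Done s i
      · linarith [hd.2.2]
      · have h1 : o.pay i ≤ A.v i * ((o.X i ∩ A.S i).card : ℝ) := by
          have : (0 : ℝ) ≤ A.v i * ((o.X i ∩ A.S i).card : ℝ) - o.pay i := by exact_mod_cast hr
          linarith
        have h2 : A.v i * ((o.X i ∩ A.S i).card : ℝ) ≤ ∑ j ∈ o.X i ∩ A.S i, val j := by
          rw [mul_comm, ← nsmul_eq_mul]
          refine Finset.card_nsmul_le_sum _ _ _ fun j hj => ?_
          rcases h.cover i j (Finset.mem_inter.1 hj).2 with h' | h' | h'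
          · exact absurd h' hd
          · simp at h'
          · exact h'.1
        have h3 : ∑ j ∈ o.X i ∩ A.S i, val j ≤ ∑ j ∈ o.X i, val j :=
          Finset.sum_le_sum_of_subset_of_nonneg Finset.inter_subset_left
            fun j _ _ => h.val_nonneg j
        linarith
    · simp at hr
  have hX : ∑ i, ∑ j ∈ o.X i, val j ≤ 2 * s.outcome.revenue := by
    rw [← Finset.sum_biUnion fun i _ i' _ hne => ho.supply i i' hne]
    refine le_trans ?_ h.val_sum
    exact Finset.sum_le_sum_of_subset_of_nonneg (fun j _ => by simp) fun j _ _ => h.val_nonneg j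
  calc o.revenue ≤ ∑ i, (2 * s.outcome.pay i + ∑ j ∈ o.X i, val j) :=
        Finset.sum_le_sum fun i _ => hi i
    _ = 2 * s.outcome.revenue + ∑ i, ∑ j ∈ o.X i, val j := by
        rw [Finset.sum_add_distrib, ← Finset.mul_sum]
        rfl
    _ ≤ 4 * s.outcome.revenue := by linarith

end Invariant

theorem eventually_gap [Finite I] (A : Market I J) (β : I → ℝ) :
    ∀ᶠ ε in 𝓝[>] (0 : ℝ), ∀ c ∈ A.breakpoints β, ∀ c' ∈ A.breakpoints β, c < c' → c + ε < c' := by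
  refine (finite_breakpoints A β).eventually_all.2 fun c _ =>
    (finite_breakpoints A β).eventually_all.2 fun c' _ => ?_
  by_cases hcc : c < c'
  · filter_upwards [Ioo_mem_nhdsGT (sub_pos.2 hcc)] with ε hε _
    linarith [hε.2]
  · exact Eventually.of_forall fun ε h => absurd h hcc

end Market

end MatchingMarketProof

theorem mainTheorem2 {I J : Type*} [Fintype I] [Fintype J] (A : Market I J)
    (hb : ∀ i, A.v i ≤ A.b i) :
    ∀ᶠ ε in 𝓝[>] (0 : ℝ), A.Terminates ε ∧
      ∀ o : Outcome I J, A.IsOutput ε o → 1 / 4 * A.optRevenue ≤ o.revenue := by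
  filter_upwards [A.eventually_gap A.b, self_mem_nhdsWithin] with ε hgap hε
  refine ⟨A.terminates hε, ?_⟩
  rintro _ ⟨s, hs, hhalt, rfl⟩
  obtain ⟨L, val, h⟩ := Market.Invariant.of_reachable hb hε hgap hs
  have : A.optRevenue ≤ 4 * s.outcome.revenue := by
    refine csSup_le A.envyFreeRevenues_nonempty ?_
    rintro _ ⟨o, ho, _, rfl⟩
    exact h.revenue_le hhalt ho
  linarith
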